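/- Let $\hat f(\xi)=\int_{\mathbb R^d} f(x)e^{-2\pi i x\cdot\xi}\,dx$ denote the Fourier transform, extended to a unitary operator on $L^2(\mathbb R^d)$, and let $T_\beta f(x)=f(x-\beta)$ for $\beta\in\mathbb R^d$. Let $\mathcal D$ be the set of $f\in L^2(\mathbb R^d)$ such that $\hat f\in L^\infty(\mathbb R^d)$ and $\operatorname{supp}\hat f$ is compact and does not contain $0$. Let $\mathcal P$ be a countable index set, let $C_p$ be an invertible real $d\times d$ matrix for each $p\in\mathcal P$, put $C_p'=(C_p^{*})^{-1}$, where $C_p^*$ is the transpose, and $$\Lambda=\bigcup_{p\in\mathcal P}C_p'\mathbb Z^d,\qquad \mathcal P_\alpha=\{p\in\mathcal P: C_p^{*}\alpha\in\mathbb Z^d\}\quad(\alpha\in\Lambda).$$ Let $g_p,h_p\in L^2(\mathbb R^d)$ ($p\in\mathcal P$). Suppose that each of the systems $\{T_{C_pk}g_p\}_{p\in\mathcal P,\,k\in\mathbb Z^d}$ and $\{T_{C_pk}h_p\}_{p\in\mathcal P,\,k\in\mathbb Z^d}$ satisfies the Bessel condition and the local integrability condition; that is, with $u=g$ and with $u=h$,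 there is $M<\infty$ such that $$\sum_{p\in\mathcal P}\sum_{k\in\mathbb Z^d}|\langle f,T_{C_pk}u_p\rangle|^2\le M\|f\|^2\quad\text{for all } f\in L^2(\mathbb R^d),$$ and $$\sum_{p\in\mathcal P}\sum_{k\in\mathbb Z^d}\int_{\operatorname{supp}\hat f}|\hat f(\xi+C_p'k)|^2\,|\det C_p|^{-1}\,|\hat u_p(\xi)|^2\,d\xi<\infty\quad\text{for all } f\in\mathcal D.$$ Let $\theta_g,\theta_h: L^2(\mathbb R^d)\to\ell^2(\mathcal P\times\mathbb Z^d)$ be the analysis operators $\theta_u f=(\langle f,T_{C_pk}u_p\rangle)_{p,k}$, and let $\Theta=\theta_g^{*}\theta_h$. Then $$\Theta f=\sum_{p\in\mathcal P}\sum_{k\in\mathbb Z^d}\langle f,T_{C_pk}h_p\rangle\,T_{C_pk}g_p\quad\text{for all } f\in L^2(\mathbb R^d),$$ with unconditional convergence in $L^2(\mathbb R^d)$. For every $\alpha\in\Lambda$ the series $\sum_{p\in\mathcal P_\alpha}|\det C_p|^{-1}\overline{\hat h_p(\xi)}\,\hat g_p(\xi+\alpha)$ converges absolutely for a.e. $\xi$.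 The operator $\Theta$ commutes with $T_\beta$ for all $\beta\in\mathbb R^d$ if and only if for every $\alpha\in\Lambda\setminus\{0\}$ $$\sum_{p\in\mathcal P_\alpha}|\det C_p|^{-1}\,\overline{\hat h_p(\xi)}\,\hat g_p(\xi+\alpha)=0\quad\text{for a.e. }\xi\in\mathbb R^d.$$ In this case $\Theta$ is a Fourier multiplier with symbol $$s(\xi)=\sum_{p\in\mathcal P}|\det C_p|^{-1}\,\overline{\hat h_p(\xi)}\,\hat g_p(\xi)$$ (this series converges absolutely for a.e. $\xi$), that is, $s\in L^\infty(\mathbb R^d)$ and $\widehat{\Theta f}(\xi)=s(\xi)\hat f(\xi)$ for a.e. $\xi$, for every $f\in L^2(\mathbb R^d)$. -/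

import Mathlib

open MeasureTheory FourierTransform
open scoped ENNReal NNReal Topology ComplexConjugate

noncomputable section

/-! ### Bessel sequences, analysis operators and mixed dual Gramians in a Hilbert space -/

section Bessel

variable {H : Type*} [NormedAddCommGroup H] [InnerProductSpace ℂ H] {ι : Type*}

/-- `x` is a Bessel sequence: there is a finite `M` with `∑ |⟨v, x_j⟩|² ≤ M ‖v‖²` for all `v`.
Mathlib's inner product is conjugate linear in its first argument, so the usual `⟨v, x_j⟩`
(linear in `v`) is `inner ℂ (x j) v`. -/
def IsBessel (x : ι → H) : Prop :=
  ∃ M : ℝ≥0, ∀ v : H, ∑' j, ‖inner ℂ (x j) v‖ₑ ^ 2 ≤ (M : ℝ≥0∞) * ‖v‖ₑ ^ 2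

theorem IsBessel.exists_bound {x : ι → H} (hx : IsBessel x) :
    ∃ M : ℝ≥0, ∀ v : H, Summable (fun j => ‖inner ℂ (x j) v‖ ^ 2) ∧
      ∑' j, ‖inner ℂ (x j) v‖ ^ 2 ≤ M * ‖v‖ ^ 2 := by
  obtain ⟨M, hM⟩ := hx
  refine ⟨M, fun v => ?_⟩
  have h1 : ∑' j, ((‖inner ℂ (x j) v‖₊ ^ 2 : ℝ≥0) : ℝ≥0∞)
      ≤ ((M * ‖v‖₊ ^ 2 : ℝ≥0) : ℝ≥0∞) := by
    have := hM v
    simpa [enorm_eq_nnnorm] using this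
  have hs : Summable (fun j => (‖inner ℂ (x j) v‖₊ ^ 2 : ℝ≥0)) :=
    ENNReal.tsum_coe_ne_top_iff_summable.1 (ne_top_of_le_ne_top ENNReal.coe_ne_top h1)
  refine ⟨by simpa using NNReal.summable_coe.2 hs, ?_⟩
  rw [← ENNReal.coe_tsum hs, ENNReal.coe_le_coe, ← NNReal.coe_le_coe] at h1
  simpa [NNReal.coe_tsum] using h1

theorem IsBessel.memℓp {x : ι → H} (hx : IsBessel x) (v : H) :
    Memℓp (fun j => (inner ℂ (x j) v : ℂ)) 2 := by
  obtain ⟨M, hM⟩ := hx.exists_bound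
  refine memℓp_gen ?_
  simpa using (hM v).1

/-- The analysis operator `v ↦ (⟨v, x_j⟩)_j` of a Bessel sequence, as a bounded operator into
`ℓ²`. -/
def analysisOp (x : ι → H) (hx : IsBessel x) : H →L[ℂ] lp (fun _ : ι => ℂ) 2 :=
  LinearMap.mkContinuousOfExistsBound
    { toFun := fun v => ⟨fun j => inner ℂ (x j) v, hx.memℓp v⟩
      map_add' := fun v w => by ext j; exact inner_add_right _ _ _
      map_smul' := fun c v => by ext j; exact inner_smul_right _ _ _ }
    (by
      obtain ⟨M, hM⟩ := hx.exists_bound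
      refine ⟨Real.sqrt M, fun v => ?_⟩
      refine lp.norm_le_of_tsum_le (by norm_num) (by positivity) ?_
      simpa [mul_pow] using (hM v).2)

variable [CompleteSpace H]

/-- The operator `θ_y^* θ_x`, where `θ_y^*` is the adjoint of the analysis operator, that is, the
synthesis operator of `y`. -/
def mixedGramian (x y : ι → H) (hx : IsBessel x) (hy : IsBessel y) : H →L[ℂ] H :=
  (ContinuousLinearMap.adjoint (analysisOp y hy)).comp (analysisOp x hx)

end Bessel

/-! ### Translations and Fourier multipliers on `L²(ℝᵈ)` -/

/-- `L²(ℝᵈ)`, with complex values and Lebesgue measure. Its Fourier transform `𝓕` is Mathlib's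
unitary extension of `f ↦ ∫ f(x) exp(-2πi x·ξ) dx`. -/
abbrev L2Space (d : ℕ) : Type := Lp ℂ 2 (volume : Measure (EuclideanSpace ℝ (Fin d)))

/-- The translation operator `(T_β f)(x) = f(x - β)`. -/
def translationOp {d : ℕ} (β : EuclideanSpace ℝ (Fin d)) : L2Space d →L[ℂ] L2Space d :=
  (Lp.compMeasurePreservingₗᵢ ℂ (fun x => x - β)
    (measurePreserving_sub_right volume β)).toContinuousLinearMap

/-- `Θ` is the Fourier multiplier with the essentially bounded symbol `s`. -/
def IsFourierMultiplier {d : ℕ} (Θ : L2Space d →L[ℂ] L2Space d)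
    (s : EuclideanSpace ℝ (Fin d) → ℂ) : Prop :=
  MemLp s ∞ volume ∧
    ∀ f : L2Space d, (𝓕 (Θ f) : L2Space d) =ᵐ[volume] fun ξ => s ξ * (𝓕 f : L2Space d) ξ

/-- The (closed, essential) support of a function defined up to null sets: the complement of the
largest open set on which it vanishes almost everywhere. -/
def essSupport {d : ℕ} (φ : EuclideanSpace ℝ (Fin d) → ℂ) : Set (EuclideanSpace ℝ (Fin d)) :=
  {ξ | ∀ U ∈ 𝓝 ξ, ¬ φ =ᵐ[volume.restrict U] 0}

/-- The space `𝒟` of those `f ∈ L²(ℝᵈ)` for which `𝓕 f` is essentially bounded and has compact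
support not containing the origin. -/
def testSpace (d : ℕ) : Set (L2Space d) :=
  {f | MemLp (𝓕 f : L2Space d) ∞ volume ∧ IsCompact (essSupport (𝓕 f : L2Space d)) ∧
    0 ∉ essSupport (𝓕 f : L2Space d)}

/-! ### General translation systems -/

/-- The vector `A k ∈ ℝᵈ` for a matrix `A` and `k ∈ ℤᵈ`. -/
def latticePoint {d : ℕ} (A : Matrix (Fin d) (Fin d) ℝ) (k : Fin d → ℤ) :
    EuclideanSpace ℝ (Fin d) :=
  WithLp.toLp 2 (A.mulVec fun i => (k i : ℝ))

/-- `C' = (C^*)⁻¹`, the inverse of the transpose. -/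
def dualMatrix {d : ℕ} (C : Matrix (Fin d) (Fin d) ℝ) : Matrix (Fin d) (Fin d) ℝ :=
  (C.transpose)⁻¹

/-- The system `{T_{C_p k} g_p : p ∈ P, k ∈ ℤᵈ}`. -/
def translationSystem {d : ℕ} {P : Type*} (C : P → Matrix (Fin d) (Fin d) ℝ) (g : P → L2Space d) :
    P × (Fin d → ℤ) → L2Space d :=
  fun pk => translationOp (latticePoint (C pk.1) pk.2) (g pk.1)

/-- The local integrability condition: for all `f ∈ 𝒟`,
`∑_p ∑_k ∫_{supp 𝓕 f} |𝓕 f (ξ + C_p' k)|² |det C_p|⁻¹ |𝓕 g_p (ξ)|² dξ < ∞`. -/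
def LocallyIntegrableSystem {d : ℕ} {P : Type*} (C : P → Matrix (Fin d) (Fin d) ℝ)
    (g : P → L2Space d) : Prop :=
  ∀ f ∈ testSpace d,
    ∑' (p : P) (k : Fin d → ℤ), ∫⁻ ξ in essSupport (𝓕 f : L2Space d),
      ‖(𝓕 f : L2Space d) (ξ + latticePoint (dualMatrix (C p)) k)‖ₑ ^ 2 *
        ENNReal.ofReal |(C p).det|⁻¹ * ‖(𝓕 (g p) : L2Space d) ξ‖ₑ ^ 2 < ⊤

/-- `Λ = ⋃_p C_p' ℤᵈ`. -/
def frequencySet {d : ℕ} {P : Type*} (C : P → Matrix (Fin d) (Fin d) ℝ) :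
    Set (EuclideanSpace ℝ (Fin d)) :=
  ⋃ p, Set.range (latticePoint (dualMatrix (C p)))

/-- `P_α = {p : C_p^* α ∈ ℤᵈ}`. -/
def activeIndices {d : ℕ} {P : Type*} (C : P → Matrix (Fin d) (Fin d) ℝ)
    (α : EuclideanSpace ℝ (Fin d)) : Set P :=
  {p | ∃ k : Fin d → ℤ, (C p).transpose.mulVec α = fun i => (k i : ℝ)}

/-- The term `|det C_p|⁻¹ conj(𝓕 h_p (ξ)) 𝓕 g_p (ξ + α)`. -/
def crossTerm {d : ℕ} {P : Type*} (C : P → Matrix (Fin d) (Fin d) ℝ) (g h : P → L2Space d)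
    (α ξ : EuclideanSpace ℝ (Fin d)) (p : P) : ℂ :=
  ((|(C p).det|⁻¹ : ℝ) : ℂ) * conj ((𝓕 (h p) : L2Space d) ξ) * (𝓕 (g p) : L2Space d) (ξ + α)

end

/-! Call `f` band limited to `K` if its Fourier transform is bounded and vanishes off `K`, where `K`
has finite measure and finite local integrability sums. For band limited `f₁`, `f₂` the object of
study is the function `x ↦ ⟨Θ T_x f₁, T_x f₂⟩`. For each `p` the sum over `C_p ℤᵈ` is a sum of
products of Fourier coefficients. Parseval's identity, obtained by periodizing along the dual
lattice, turns it into a sum of correlations over the dual frequencies `C_p' l`, in which `x` enters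
only through the character of that frequency.

Local integrability and `ab ≤ a² + b²` make the series over all `(p, l)` converge absolutely
(`LocallyFiniteOn.hasSum_inner_mixedGramian`). Each `p ∈ P_α` has exactly one `l` with `C_p' l = α`,
so the coefficient at `α` is the integral of `𝓕 f₁(ξ) conj(𝓕 f₂(ξ + α))` against the cross sum at
`α` (`LocallyFiniteOn.tsum_indicator_gramianCoeff`).

If `Θ` commutes with translations, these functions are constant, so their coefficients at nonzero
frequencies vanish; this uniqueness comes from averaging against spreading Gaussians
(`tsum_coeff_eq_zero_of_hasSum_const`). Letting `𝓕 f₁` be the conjugate phase of the cross sum turns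
the coefficient into the integral of its modulus, which must then be zero. Conversely, if the cross
sums vanish for `α ≠ 0`, only frequency zero survives and `⟨Θ f₁, f₂⟩` is the integral of `𝓕 f₁
conj(𝓕 f₂) s`. The same choice of phase bounds `|s|` by `‖Θ‖`, and density of the band limited
functions gives the statement on all of `L²`. -/

/-! ### Periodization and Parseval's identity -/

section Periodization

variable {ι : Type*}

/-- The integer vector `m` as a real vector. -/
def intVec (m : ι → ℤ) : ι → ℝ := fun i => (m i : ℝ)

theorem intVec_add (m n : ι → ℤ) : intVec (m + n) = intVec m + intVec n := by
  ext i; simp [intVec]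

/-- The half open cube with lower corner `a` and side length one. -/
def unitCube (a : ι → ℝ) : Set (ι → ℝ) := {x | ∀ i, x i ∈ Set.Ioc (a i) (a i + 1)}

/-- Half-openness makes the corner a function of the point, which yields both disjointness and
covering. -/
theorem mem_unitCube_intVec_iff (m : ι → ℤ) (x : ι → ℝ) :
    x ∈ unitCube (intVec m) ↔ (fun i => ⌈x i⌉ - 1) = m := by
  simp only [unitCube, intVec, Set.mem_ofPred_eq, Set.mem_Ioc, funext_iff]
  refine forall_congr' fun i => ?_
  rw [sub_eq_iff_eq_add, Int.ceil_eq_iff]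
  push_cast
  simp

theorem pairwise_disjoint_unitCube :
    Pairwise (Function.onFun Disjoint fun m : ι → ℤ => unitCube (intVec m)) := by
  intro m n hmn
  refine Set.disjoint_left.2 fun x hx hx' => hmn ?_
  rw [mem_unitCube_intVec_iff] at hx hx'
  exact hx.symm.trans hx'

theorem iUnion_unitCube : ⋃ m : ι → ℤ, unitCube (intVec m) = Set.univ := by
  ext x
  simp [mem_unitCube_intVec_iff]

theorem preimage_add_unitCube (m : ι → ℤ) :
    (fun x => x + intVec m) ⁻¹' unitCube (intVec m) = unitCube 0 := by
  ext x
  simp only [unitCube, Set.mem_preimage, Set.mem_ofPred_eq, Set.mem_Ioc, Pi.add_apply,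
    Pi.zero_apply]
  refine forall_congr' fun i => ?_
  constructor <;> rintro ⟨h1, h2⟩ <;> constructor <;> linarith

/-- The sum of all integer translates of `φ`. -/
noncomputable def periodization (φ : (ι → ℝ) → ℂ) (x : ι → ℝ) : ℂ :=
  ∑' m : ι → ℤ, φ (x + intVec m)

theorem periodization_add (φ : (ι → ℝ) → ℂ) (x : ι → ℝ) (n : ι → ℤ) :
    periodization φ (x + intVec n) = periodization φ x := by
  unfold periodization
  rw [← (Equiv.addLeft n).tsum_eq (fun m => φ (x + intVec m))]
  refine tsum_congr fun m => ?_
  rw [Equiv.coe_addLeft, intVec_add, add_assoc]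

variable [Fintype ι]

theorem measurableSet_unitCube (a : ι → ℝ) : MeasurableSet (unitCube a) :=
  MeasurableSet.univ_pi' fun _ => measurableSet_Ioc

/-- Unfolding: the cubes with integer corners tile space, and each is a translate of the base cube.
-/
theorem lintegral_unitCube_tsum {F : (ι → ℝ) → ℝ≥0∞} (hF : Measurable F) :
    ∫⁻ x in unitCube 0, ∑' m : ι → ℤ, F (x + intVec m) = ∫⁻ x, F x := by
  have hFm : ∀ m : ι → ℤ, Measurable fun x => F (x + intVec m) := fun m =>
    hF.comp (measurable_add_const _)
  rw [lintegral_tsum fun m => (hFm m).aemeasurable,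
    ← setLIntegral_univ F, ← iUnion_unitCube,
    lintegral_iUnion (fun m => measurableSet_unitCube _) pairwise_disjoint_unitCube]
  refine tsum_congr fun m => ?_
  rw [← preimage_add_unitCube m]
  exact (measurePreserving_add_right volume (intVec m)).setLIntegral_comp_preimage
    (measurableSet_unitCube _) hF

theorem integral_unitCube_tsum {F : (ι → ℝ) → ℂ} (hF : Measurable F) (hi : Integrable F) :
    ∫ x in unitCube 0, ∑' m : ι → ℤ, F (x + intVec m) = ∫ x, F x := by
  have hFm : ∀ m : ι → ℤ, Measurable fun x => F (x + intVec m) := fun m =>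
    hF.comp (measurable_add_const _)
  rw [integral_tsum fun m => (hFm m).aestronglyMeasurable]
  · rw [← setIntegral_univ (f := F), ← iUnion_unitCube,
      integral_iUnion (fun m => measurableSet_unitCube _) pairwise_disjoint_unitCube
        hi.integrableOn]
    refine tsum_congr fun m => ?_
    rw [← preimage_add_unitCube m]
    exact (measurePreserving_add_right volume (intVec m)).setIntegral_preimage_emb
      (MeasurableEquiv.addRight (intVec m)).measurableEmbedding F (unitCube (intVec m))
  · rw [← lintegral_tsum fun m => (hFm m).enorm.aemeasurable, lintegral_unitCube_tsum hF.enorm]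
    exact hi.2.ne

theorem measurable_periodization {φ : (ι → ℝ) → ℂ} (hφ : Measurable φ) :
    Measurable (periodization φ) :=
  Measurable.tsum fun _ => hφ.comp (measurable_add_const _)

/-- A periodic factor passes inside the sum before unfolding. It is used with `G` a character, for
Fourier coefficients, and with `G` a conjugate periodization, for inner products. -/
theorem integral_unitCube_periodization_mul {φ G : (ι → ℝ) → ℂ} (hφ : Measurable φ)
    (hG : Measurable G) (hper : ∀ x (m : ι → ℤ), G (x + intVec m) = G x)
    (hi : Integrable fun x => φ x * G x) :
    ∫ x in unitCube 0, periodization φ x * G x = ∫ x, φ x * G x := by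
  refine Eq.trans ?_ (integral_unitCube_tsum (hφ.mul hG) hi)
  refine integral_congr_ae (Filter.Eventually.of_forall fun x => ?_)
  simp only [periodization, hper, tsum_mul_right]

/-- Integrability of `∑_m |φ(x)| |ψ(x + m)|`. -/
def CorrelationFinite (φ ψ : (ι → ℝ) → ℂ) : Prop :=
  ∑' m : ι → ℤ, ∫⁻ x, ‖φ x‖ₑ * ‖ψ (x + intVec m)‖ₑ < ⊤

/-- With `S` the periodization of `|φ|`, the square is at most `S · S`. Unfolding one copy of `S`
and keeping the other, which is periodic, leaves exactly the correlation sum. -/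
theorem lintegral_enorm_periodization_sq_lt_top {φ : (ι → ℝ) → ℂ} (hφ : Measurable φ)
    (h : CorrelationFinite φ φ) :
    ∫⁻ x in unitCube 0, ‖periodization φ x‖ₑ ^ 2 < ⊤ := by
  set S : (ι → ℝ) → ℝ≥0∞ := fun x => ∑' m : ι → ℤ, ‖φ (x + intVec m)‖ₑ with hS
  have hSm : Measurable S := Measurable.tsum fun m =>
    (hφ.comp (measurable_add_const _)).enorm
  have hper : ∀ x (n : ι → ℤ), S (x + intVec n) = S x := by
    intro x n
    simp only [hS]
    rw [← (Equiv.addLeft n).tsum_eq (fun m => ‖φ (x + intVec m)‖ₑ)]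
    refine tsum_congr fun m => ?_
    rw [Equiv.coe_addLeft, intVec_add, add_assoc]
  calc ∫⁻ x in unitCube 0, ‖periodization φ x‖ₑ ^ 2
      ≤ ∫⁻ x in unitCube 0, ∑' m : ι → ℤ, ‖φ (x + intVec m)‖ₑ * S (x + intVec m) := by
        refine lintegral_mono fun x => ?_
        simp only [hper]
        rw [ENNReal.tsum_mul_right, sq]
        exact mul_le_mul' enorm_tsum_le_tsum_enorm enorm_tsum_le_tsum_enorm
    _ = ∫⁻ x, ‖φ x‖ₑ * S x := lintegral_unitCube_tsum (hφ.enorm.mul hSm)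
    _ = ∑' m : ι → ℤ, ∫⁻ x, ‖φ x‖ₑ * ‖φ (x + intVec m)‖ₑ := by
        simp only [hS, ← ENNReal.tsum_mul_left]
        exact lintegral_tsum fun m =>
          (hφ.enorm.mul (hφ.comp (measurable_add_const _)).enorm).aemeasurable
    _ < ⊤ := h

/-- Only the first periodization is unfolded; expanding the second gives the correlations. The
finiteness hypothesis is what Fubini requires. -/
theorem integral_unitCube_periodization_mul_conj {φ ψ : (ι → ℝ) → ℂ} (hφ : Measurable φ)
    (hψ : Measurable ψ) (h : CorrelationFinite φ ψ) :
    ∫ x in unitCube 0, periodization φ x * conj (periodization ψ x) =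
      ∑' m : ι → ℤ, ∫ x, φ x * conj (ψ (x + intVec m)) := by
  have hm : ∀ m : ι → ℤ, Measurable fun x => φ x * conj (ψ (x + intVec m)) := fun m =>
    hφ.mul (Complex.continuous_conj.measurable.comp (hψ.comp (measurable_add_const _)))
  have hfin : ∑' m : ι → ℤ, ∫⁻ x, ‖φ x * conj (ψ (x + intVec m))‖ₑ < ⊤ := by
    simpa [CorrelationFinite, enorm_mul] using h
  have hGm : Measurable fun x => conj (periodization ψ x) :=
    Complex.continuous_conj.measurable.comp (measurable_periodization hψ)
  rw [integral_unitCube_periodization_mul (G := fun x => conj (periodization ψ x)) hφ hGm]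
  · rw [← integral_tsum (fun m => (hm m).aestronglyMeasurable) hfin.ne]
    refine integral_congr_ae (Filter.Eventually.of_forall fun x => ?_)
    simp only [periodization, tsum_mul_left, Complex.conj_tsum]
  · intro x m
    rw [periodization_add]
  · refine ⟨(hφ.mul hGm).aestronglyMeasurable, lt_of_le_of_lt ?_ hfin⟩
    rw [← lintegral_tsum fun m => (hm m).enorm.aemeasurable]
    refine lintegral_mono fun x => ?_
    simp only [enorm_mul, ENNReal.tsum_mul_left, RCLike.enorm_conj]
    gcongr
    exact enorm_tsum_le_tsum_enorm

end Periodization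

/-! ### Parseval's identity on the torus, pulled back to the unit cube. -/

section Parseval

variable {ι : Type*}

noncomputable local instance : MeasureSpace UnitAddCircle := ⟨AddCircle.haarAddCircle⟩

local instance : Measure.IsAddHaarMeasure (volume : Measure UnitAddCircle) :=
  inferInstanceAs (Measure.IsAddHaarMeasure AddCircle.haarAddCircle)

local instance : IsProbabilityMeasure (volume : Measure UnitAddCircle) :=
  inferInstanceAs (IsProbabilityMeasure AddCircle.haarAddCircle)

/-- The function on the torus that is given by `A` on the unit cube. -/
noncomputable def torusLift (A : (ι → ℝ) → ℂ) (t : UnitAddTorus ι) : ℂ :=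
  A (UnitAddTorus.measurableEquivPiIoc (0 : ι → ℝ) t).1

theorem measurable_torusLift {A : (ι → ℝ) → ℂ} (hA : Measurable A) : Measurable (torusLift A) :=
  hA.comp (measurable_subtype_coe.comp (UnitAddTorus.measurableEquivPiIoc (0 : ι → ℝ)).measurable)

theorem torusLift_coe (A : (ι → ℝ) → ℂ) {x : ι → ℝ} (hx : x ∈ unitCube 0) :
    torusLift A (fun i => (x i : UnitAddCircle)) = A x := by
  have := (UnitAddTorus.measurableEquivPiIoc (0 : ι → ℝ)).apply_symm_apply ⟨x, hx⟩
  rw [UnitAddTorus.coe_symm_measurableEquivPiIoc_apply] at this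
  unfold torusLift
  rw [this]

variable [Fintype ι]

theorem mFourier_coe (n : ι → ℤ) (x : ι → ℝ) :
    UnitAddTorus.mFourier n (fun i => (x i : UnitAddCircle)) =
      (Real.fourierChar (∑ i, (n i : ℝ) * x i) : ℂ) := by
  simp only [UnitAddTorus.mFourier, ContinuousMap.coe_mk, fourier_coe_apply,
    Real.fourierChar_apply, ← Complex.exp_sum]
  congr 1
  push_cast
  rw [Finset.mul_sum, Finset.sum_mul]
  refine Finset.sum_congr rfl fun i _ => ?_
  ring

theorem memLp_torusLift {A : (ι → ℝ) → ℂ} (hA : Measurable A)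
    (h : ∫⁻ x in unitCube 0, ‖A x‖ₑ ^ 2 < ⊤) :
    MemLp (torusLift A) 2 (volume : Measure (UnitAddTorus ι)) := by
  refine ⟨(measurable_torusLift hA).aestronglyMeasurable, ?_⟩
  rw [eLpNorm_lt_top_iff_lintegral_rpow_enorm_lt_top (by norm_num) (by norm_num)]
  rw [UnitAddTorus.lintegral_preimage _ (0 : ι → ℝ)]
  refine lt_of_eq_of_lt (setLIntegral_congr_fun (measurableSet_unitCube _) fun x hx => ?_) h
  rw [torusLift_coe A hx]
  norm_num

/-- Parseval's identity for the sequence of values at the integers of the Fourier transforms of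
two functions on `ℝⁿ`. -/
theorem hasSum_integral_fourierChar_mul_conj {φ ψ : (ι → ℝ) → ℂ} (hφ : Measurable φ)
    (hψ : Measurable ψ) (hφi : Integrable φ) (hψi : Integrable ψ)
    (hφφ : CorrelationFinite φ φ) (hψψ : CorrelationFinite ψ ψ) (hφψ : CorrelationFinite φ ψ) :
    HasSum (fun k : ι → ℤ =>
        (∫ x, φ x * (Real.fourierChar (∑ i, (k i : ℝ) * x i) : ℂ)) *
          conj (∫ x, ψ x * (Real.fourierChar (∑ i, (k i : ℝ) * x i) : ℂ)))
      (∑' m : ι → ℤ, ∫ x, φ x * conj (ψ (x + intVec m))) := by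
  have hmem : ∀ χ : (ι → ℝ) → ℂ, Measurable χ → CorrelationFinite χ χ →
      MemLp (torusLift (periodization χ)) 2 (volume : Measure (UnitAddTorus ι)) := fun χ hχ hχχ =>
    memLp_torusLift (measurable_periodization hχ) (lintegral_enorm_periodization_sq_lt_top hχ hχχ)
  -- The index is `-k` because `mFourierCoeff` integrates against the character of the negated
  -- index; the final sum is reindexed by negation.
  have hcoeff : ∀ (χ : (ι → ℝ) → ℂ) (hχ : Measurable χ) (hχχ : CorrelationFinite χ χ),
      Integrable χ → ∀ k : ι → ℤ,
      UnitAddTorus.mFourierCoeff ((hmem χ hχ hχχ).toLp _ : UnitAddTorus ι → ℂ) (-k) =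
        ∫ x, χ x * (Real.fourierChar (∑ i, (k i : ℝ) * x i) : ℂ) := by
    intro χ hχ hχχ hχi k
    have hE : Measurable fun x : ι → ℝ => (Real.fourierChar (∑ i, (k i : ℝ) * x i) : ℂ) := by
      have : Continuous fun x : ι → ℝ => (Real.fourierChar (∑ i, (k i : ℝ) * x i) : ℂ) :=
        continuous_subtype_val.comp (Real.continuous_fourierChar.comp (by fun_prop))
      exact this.measurable
    have h1 : UnitAddTorus.mFourierCoeff ((hmem χ hχ hχχ).toLp _ : UnitAddTorus ι → ℂ) (-k) =
        UnitAddTorus.mFourierCoeff (torusLift (periodization χ)) (-k) := by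
      unfold UnitAddTorus.mFourierCoeff
      refine integral_congr_ae ?_
      filter_upwards [(hmem χ hχ hχχ).coeFn_toLp] with t ht
      rw [ht]
    rw [h1, UnitAddTorus.mFourierCoeff_eq_integral _ _ (0 : ι → ℝ),
      ← integral_unitCube_periodization_mul hχ hE]
    · refine setIntegral_congr_fun (measurableSet_unitCube _) fun x hx => ?_
      rw [neg_neg, torusLift_coe _ hx, mFourier_coe, smul_eq_mul, mul_comm]
    -- The character of `k` is invariant under integer translations, since `k · m` is an integer.
    · intro x m
      have : ∑ i, (k i : ℝ) * (x + intVec m) i =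
          ∑ i, (k i : ℝ) * x i + ((∑ i, k i * m i : ℤ) : ℝ) := by
        push_cast
        rw [← Finset.sum_add_distrib]
        refine Finset.sum_congr rfl fun i _ => ?_
        simp [intVec]
        ring
      rw [this, AddChar.map_add_eq_mul]
      have h2 : (Real.fourierChar ((∑ i, k i * m i : ℤ) : ℝ) : ℂ) = 1 := by
        rw [Real.fourierChar_apply, Complex.exp_eq_one_iff]
        exact ⟨∑ i, k i * m i, by push_cast; ring⟩
      rw [Circle.coe_mul, h2, mul_one]
    · refine hχi.mul_bdd (c := 1) hE.aestronglyMeasurable (Filter.Eventually.of_forall fun x => ?_)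
      exact (Circle.norm_coe _).le
  -- The torus identity conjugates its first argument, so `ψ` comes first.
  have key := UnitAddTorus.hasSum_prod_mFourierCoeff ((hmem ψ hψ hψψ).toLp _)
    ((hmem φ hφ hφφ).toLp _)
  have key2 := (Equiv.neg (ι → ℤ)).hasSum_iff.2 key
  convert key2 using 1
  · ext k
    simp only [Function.comp_apply, Equiv.neg_apply]
    rw [hcoeff ψ hψ hψψ hψi, hcoeff φ hφ hφφ hφi, mul_comm]
  · rw [← integral_unitCube_periodization_mul_conj hφ hψ hφψ]
    have h1 : ∫ t, conj (((hmem ψ hψ hψψ).toLp _ : UnitAddTorus ι → ℂ) t) *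
          ((hmem φ hφ hφφ).toLp _ : UnitAddTorus ι → ℂ) t =
        ∫ t, conj (torusLift (periodization ψ) t) * torusLift (periodization φ) t := by
      refine integral_congr_ae ?_
      filter_upwards [(hmem ψ hψ hψψ).coeFn_toLp, (hmem φ hφ hφφ).coeFn_toLp] with t ht1 ht2
      rw [ht1, ht2]
    rw [h1, UnitAddTorus.integral_preimage _ (0 : ι → ℝ)]
    refine setIntegral_congr_fun (measurableSet_unitCube _) fun x hx => ?_
    rw [torusLift_coe _ hx, torusLift_coe _ hx, mul_comm]

end Parseval

/-! ### The mixed dual Gramian as a sum of rank one operators -/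

section MixedGramian

variable {H : Type*} [NormedAddCommGroup H] [InnerProductSpace ℂ H] [CompleteSpace H] {ι : Type*}

theorem adjoint_analysisOp_single [DecidableEq ι] {y : ι → H} (hy : IsBessel y) (j : ι) (a : ℂ) :
    ContinuousLinearMap.adjoint (analysisOp y hy) (lp.single 2 j a) = a • y j := by
  refine ext_inner_left ℂ fun v => ?_
  rw [ContinuousLinearMap.adjoint_inner_right, lp.inner_single_right, inner_smul_right]
  change inner ℂ (inner ℂ (y j) v) a = _
  rw [RCLike.inner_apply, inner_conj_symm]

/-- In `ℓ²` the coefficient sequence is the unconditional sum of its one-entry pieces, and the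
bounded synthesis operator may be applied to each piece. -/
theorem hasSum_mixedGramian {x y : ι → H} (hx : IsBessel x) (hy : IsBessel y) (v : H) :
    HasSum (fun j => (inner ℂ (x j) v : ℂ) • y j) (mixedGramian x y hx hy v) := by
  classical
  have h := (lp.hasSum_single (p := 2) (by norm_num) (analysisOp x hx v)).mapL
    (ContinuousLinearMap.adjoint (analysisOp y hy))
  simp only [adjoint_analysisOp_single] at h
  exact h

end MixedGramian

/-! ### Translations and the Fourier transform on `L²` -/

section Translation

variable {d : ℕ}

theorem continuous_fourierChar_inner (β : EuclideanSpace ℝ (Fin d)) :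
    Continuous fun ξ : EuclideanSpace ℝ (Fin d) => (Real.fourierChar (inner ℝ β ξ) : ℂ) :=
  continuous_subtype_val.comp (Real.continuous_fourierChar.comp (by fun_prop))

theorem memLp_mul_fourierChar (β : EuclideanSpace ℝ (Fin d)) (f : L2Space d) :
    MemLp (fun ξ => (f ξ : ℂ) * (Real.fourierChar (inner ℝ β ξ) : ℂ)) 2 volume := by
  refine (Lp.memLp f).congr_norm ((Lp.aestronglyMeasurable f).mul
    (continuous_fourierChar_inner β).aestronglyMeasurable) (Filter.Eventually.of_forall fun ξ => ?_)
  rw [norm_mul, Circle.norm_coe, mul_one]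

theorem translationOp_toLp (β : EuclideanSpace ℝ (Fin d))
    (φ : SchwartzMap (EuclideanSpace ℝ (Fin d)) ℂ) :
    translationOp β (φ.toLp 2) = (φ.compSubConstCLM ℂ β).toLp 2 := by
  refine Lp.ext ?_
  have h1 : translationOp β (φ.toLp 2) =ᵐ[volume] (φ.toLp 2 : L2Space d) ∘ fun x => x - β :=
    Lp.coeFn_compMeasurePreserving _ (measurePreserving_sub_right volume β)
  have h2 := (measurePreserving_sub_right volume β).quasiMeasurePreserving.ae_eq_comp
    (φ.coeFn_toLp 2 volume)
  refine h1.trans (h2.trans ?_)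
  filter_upwards [(φ.compSubConstCLM ℂ β).coeFn_toLp 2 volume] with x hx
  rw [hx]
  rfl

theorem fourier_compSubConstCLM (β : EuclideanSpace ℝ (Fin d))
    (φ : SchwartzMap (EuclideanSpace ℝ (Fin d)) ℂ) (ξ : EuclideanSpace ℝ (Fin d)) :
    𝓕 (φ.compSubConstCLM ℂ β) ξ = (Real.fourierChar (-inner ℝ β ξ) : ℂ) * 𝓕 φ ξ := by
  have h := congrFun (VectorFourier.fourierIntegral_comp_add_right Real.fourierChar volume
    (innerₗ (EuclideanSpace ℝ (Fin d))) (fun x => φ x) (-β)) ξ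
  rw [SchwartzMap.fourier_coe, SchwartzMap.fourier_coe]
  simp only [innerₗ_apply_apply, inner_neg_left, Circle.smul_def, smul_eq_mul] at h
  have hcomp : (φ.compSubConstCLM ℂ β : EuclideanSpace ℝ (Fin d) → ℂ) =
      (fun x => φ x) ∘ fun x => x + -β := by
    ext x
    simp [sub_eq_add_neg]
  rw [hcomp]
  exact h

/-- The inner product with a translate, computed on the Fourier side. -/
theorem inner_translationOp (β : EuclideanSpace ℝ (Fin d)) (h f : L2Space d) :
    (inner ℂ (translationOp β h) f : ℂ) =
      ∫ ξ, (𝓕 f : L2Space d) ξ * conj ((𝓕 h : L2Space d) ξ) *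
        (Real.fourierChar (inner ℝ β ξ) : ℂ) := by
  -- The character is attached to `𝓕 f`, so both sides become continuous in `h` and it suffices to
  -- take `h` Schwartz, where the Fourier transform is an integral.
  set w : L2Space d := (memLp_mul_fourierChar β (𝓕 f : L2Space d)).toLp _ with hw
  have hwc := (memLp_mul_fourierChar β (𝓕 f : L2Space d)).coeFn_toLp
  have key : (inner ℂ (translationOp β h) f : ℂ) = inner ℂ (𝓕 h : L2Space d) w := by
    refine DenseRange.induction_on (p := fun h : L2Space d =>
      (inner ℂ (translationOp β h) f : ℂ) = inner ℂ (𝓕 h : L2Space d) w)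
      (SchwartzMap.denseRange_toLpCLM (E := EuclideanSpace ℝ (Fin d)) (F := ℂ) (p := 2)
        (μ := volume) ENNReal.ofNat_ne_top) h ?_ ?_
    · exact isClosed_eq (by fun_prop)
        (((Lp.fourierTransformₗᵢ (EuclideanSpace ℝ (Fin d)) ℂ).continuous).inner continuous_const)
    · intro φ
      rw [SchwartzMap.toLpCLM_apply, translationOp_toLp, ← Lp.inner_fourier_eq,
        SchwartzMap.toLp_fourier_eq, SchwartzMap.toLp_fourier_eq, L2.inner_def, L2.inner_def]
      refine integral_congr_ae ?_
      filter_upwards [hwc, (𝓕 φ).coeFn_toLp 2 volume,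
        (𝓕 (φ.compSubConstCLM ℂ β)).coeFn_toLp 2 volume] with ξ h1 h2 h3
      rw [h1, h2, h3, fourier_compSubConstCLM]
      simp only [RCLike.inner_apply, map_mul, AddChar.map_neg_eq_inv, Circle.coe_inv_eq_conj,
        Complex.conj_conj]
      ring
  rw [key, L2.inner_def]
  refine integral_congr_ae ?_
  filter_upwards [hwc] with ξ h1
  rw [h1, RCLike.inner_apply]
  ring

theorem translationOp_add_apply (β γ : EuclideanSpace ℝ (Fin d)) (f : L2Space d) :
    translationOp β (translationOp γ f) = translationOp (γ + β) f := by
  refine Lp.ext ?_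
  have h1 : translationOp β (translationOp γ f) =ᵐ[volume]
      (translationOp γ f : L2Space d) ∘ fun x => x - β :=
    Lp.coeFn_compMeasurePreserving _ (measurePreserving_sub_right volume β)
  have h2 : translationOp γ f =ᵐ[volume] f ∘ fun x => x - γ :=
    Lp.coeFn_compMeasurePreserving _ (measurePreserving_sub_right volume γ)
  have h3 : translationOp (γ + β) f =ᵐ[volume] f ∘ fun x => x - (γ + β) :=
    Lp.coeFn_compMeasurePreserving _ (measurePreserving_sub_right volume (γ + β))
  refine h1.trans (((measurePreserving_sub_right volume β).quasiMeasurePreserving.ae_eq_comp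
    h2).trans (Filter.EventuallyEq.trans ?_ h3.symm))
  refine Filter.Eventually.of_forall fun x => ?_
  simp only [Function.comp_apply]
  rw [add_comm, sub_sub]

theorem translationOp_zero (f : L2Space d) :
    translationOp (0 : EuclideanSpace ℝ (Fin d)) f = f := by
  refine Lp.ext ?_
  have h1 : translationOp (0 : EuclideanSpace ℝ (Fin d)) f =ᵐ[volume] f ∘ fun x => x - 0 :=
    Lp.coeFn_compMeasurePreserving _ (measurePreserving_sub_right volume 0)
  refine h1.trans (Filter.Eventually.of_forall fun x => ?_)
  rw [Function.comp_apply, sub_zero]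

theorem inner_translationOp_translationOp (β : EuclideanSpace ℝ (Fin d)) (f₁ f₂ : L2Space d) :
    (inner ℂ (translationOp β f₁) (translationOp β f₂) : ℂ) = inner ℂ f₁ f₂ :=
  (Lp.compMeasurePreservingₗᵢ ℂ (fun x => x - β)
    (measurePreserving_sub_right volume β)).inner_map_map f₁ f₂

/-- The inner product of a translate with another translate, computed on the Fourier side. -/
theorem inner_translationOp_translationOp_fourier (β γ : EuclideanSpace ℝ (Fin d))
    (h f : L2Space d) :
    (inner ℂ (translationOp β h) (translationOp γ f) : ℂ) =
      ∫ ξ, (𝓕 f : L2Space d) ξ * conj ((𝓕 h : L2Space d) ξ) *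
        (Real.fourierChar (-inner ℝ γ ξ) : ℂ) * (Real.fourierChar (inner ℝ β ξ) : ℂ) := by
  have h1 : translationOp β h = translationOp γ (translationOp (β - γ) h) := by
    rw [translationOp_add_apply, sub_add_cancel]
  rw [h1, inner_translationOp_translationOp, inner_translationOp]
  congr 1 with ξ
  rw [inner_sub_left, sub_eq_add_neg, add_comm, AddChar.map_add_eq_mul, Circle.coe_mul, mul_assoc,
    mul_assoc, mul_assoc]

end Translation

/-! ### Parseval's identity for general lattices -/

section Lattice

variable {d : ℕ} (C : Matrix (Fin d) (Fin d) ℝ)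

/-- The linear parametrization of `ℝᵈ` that takes `ℤᵈ` to the dual lattice of `C ℤᵈ`. -/
noncomputable def dualParam (η : Fin d → ℝ) : EuclideanSpace ℝ (Fin d) :=
  WithLp.toLp 2 ((dualMatrix C).mulVec η)

theorem measurable_dualParam : Measurable (dualParam C) :=
  (WithLp.measurable_toLp 2 (Fin d → ℝ)).comp
    ((dualMatrix C).mulVecLin.continuous_of_finiteDimensional).measurable

theorem dualParam_intVec (l : Fin d → ℤ) : dualParam C (intVec l) = latticePoint (dualMatrix C) l :=
  rfl

theorem dualParam_add (η ζ : Fin d → ℝ) : dualParam C (η + ζ) = dualParam C η + dualParam C ζ := by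
  simp [dualParam, Matrix.mulVec_add]

variable {C}

/-- Because `Cᵀ C' = 1`, the substitution `ξ = C' η` turns the characters of the lattice `C ℤᵈ` into
the standard ones. -/
theorem inner_latticePoint_dualParam (hC : IsUnit C) (k : Fin d → ℤ) (η : Fin d → ℝ) :
    inner ℝ (latticePoint C k) (dualParam C η) = ∑ i, (k i : ℝ) * η i := by
  have hdet : IsUnit C.det := (Matrix.isUnit_iff_isUnit_det C).1 hC
  rw [EuclideanSpace.inner_eq_star_dotProduct]
  simp only [latticePoint, dualParam, star_trivial, dualMatrix]
  rw [← Matrix.vecMul_transpose, ← Matrix.dotProduct_mulVec, Matrix.mulVec_mulVec,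
    Matrix.transpose_nonsing_inv, Matrix.transpose_transpose, Matrix.nonsing_inv_mul _ hdet,
    Matrix.one_mulVec, dotProduct_comm]
  rfl

theorem det_dualMatrix : (dualMatrix C).det = (C.det)⁻¹ := by
  rw [dualMatrix, Matrix.det_nonsing_inv, Matrix.det_transpose, Ring.inverse_eq_inv']

theorem map_dualParam (hC : IsUnit C) :
    (volume : Measure (Fin d → ℝ)).map (dualParam C) = ENNReal.ofReal |C.det| • volume := by
  have hdet : C.det ≠ 0 := ((Matrix.isUnit_iff_isUnit_det C).1 hC).ne_zero
  have h1 : dualParam C = WithLp.toLp 2 ∘ Matrix.toLin' (dualMatrix C) := rfl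
  rw [h1, ← Measure.map_map (WithLp.measurable_toLp 2 (Fin d → ℝ))
    (Matrix.toLin' (dualMatrix C)).continuous_of_finiteDimensional.measurable,
    Real.map_matrix_volume_pi_eq_smul_volume_pi (by rw [det_dualMatrix]; exact inv_ne_zero hdet),
    Measure.map_smul, det_dualMatrix, inv_inv, (PiLp.volume_preserving_toLp (Fin d)).map_eq]

theorem lintegral_comp_dualParam (hC : IsUnit C) {F : EuclideanSpace ℝ (Fin d) → ℝ≥0∞}
    (hF : Measurable F) :
    ∫⁻ η, F (dualParam C η) = ENNReal.ofReal |C.det| * ∫⁻ ξ, F ξ := by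
  rw [← lintegral_map hF (measurable_dualParam C), map_dualParam hC, lintegral_smul_measure,
    smul_eq_mul]

theorem integral_comp_dualParam (hC : IsUnit C) {F : EuclideanSpace ℝ (Fin d) → ℂ}
    (hF : Measurable F) :
    ∫ η, F (dualParam C η) = (|C.det| : ℝ) * ∫ ξ, F ξ := by
  rw [← integral_map (measurable_dualParam C).aemeasurable hF.aestronglyMeasurable,
    map_dualParam hC, integral_smul_measure, ENNReal.toReal_ofReal (abs_nonneg _),
    Complex.real_smul]

theorem integrable_comp_dualParam (hC : IsUnit C) {F : EuclideanSpace ℝ (Fin d) → ℂ}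
    (hFi : Integrable F) : Integrable fun η => F (dualParam C η) := by
  have h : Integrable F ((volume : Measure (Fin d → ℝ)).map (dualParam C)) := by
    rw [map_dualParam hC]
    exact hFi.smul_measure ENNReal.ofReal_ne_top
  exact h.comp_measurable (measurable_dualParam C)

/-- Finiteness of `∑ ∫ |Φ(ξ)| |Ψ(ξ + λ)| dξ`, the sum being over the dual lattice of `C ℤᵈ`. -/
def LatticeCorrelationFinite (C : Matrix (Fin d) (Fin d) ℝ)
    (Φ Ψ : EuclideanSpace ℝ (Fin d) → ℂ) : Prop :=
  ∑' l : Fin d → ℤ, ∫⁻ ξ, ‖Φ ξ‖ₑ * ‖Ψ (ξ + latticePoint (dualMatrix C) l)‖ₑ < ⊤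

theorem LatticeCorrelationFinite.correlationFinite (hC : IsUnit C)
    {Φ Ψ : EuclideanSpace ℝ (Fin d) → ℂ} (hΦ : Measurable Φ) (hΨ : Measurable Ψ)
    (h : LatticeCorrelationFinite C Φ Ψ) :
    CorrelationFinite (fun η => Φ (dualParam C η)) (fun η => Ψ (dualParam C η)) := by
  have h1 : ∀ l : Fin d → ℤ,
      ∫⁻ η, ‖Φ (dualParam C η)‖ₑ * ‖Ψ (dualParam C (η + intVec l))‖ₑ =
      ENNReal.ofReal |C.det| *
        ∫⁻ ξ, ‖Φ ξ‖ₑ * ‖Ψ (ξ + latticePoint (dualMatrix C) l)‖ₑ := by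
    intro l
    simp only [dualParam_add, dualParam_intVec]
    exact lintegral_comp_dualParam hC
      (F := fun ξ => ‖Φ ξ‖ₑ * ‖Ψ (ξ + latticePoint (dualMatrix C) l)‖ₑ)
      (hΦ.enorm.mul (hΨ.comp (measurable_add_const _)).enorm)
  simp only [CorrelationFinite, h1, ENNReal.tsum_mul_left]
  exact ENNReal.mul_lt_top ENNReal.ofReal_lt_top h

/-- Substitute `ξ = C' η` in the integer case. The two coefficients on the left each acquire a
factor `|det C|` and the correlation on the right only one, which leaves `|det C|⁻¹`. -/
theorem hasSum_lattice_integral_mul_conj (hC : IsUnit C)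
    {Φ Ψ : EuclideanSpace ℝ (Fin d) → ℂ} (hΦ : Measurable Φ) (hΨ : Measurable Ψ)
    (hΦi : Integrable Φ) (hΨi : Integrable Ψ) (hΦΦ : LatticeCorrelationFinite C Φ Φ)
    (hΨΨ : LatticeCorrelationFinite C Ψ Ψ) (hΦΨ : LatticeCorrelationFinite C Φ Ψ) :
    HasSum (fun k : Fin d → ℤ =>
        (∫ ξ, Φ ξ * (Real.fourierChar (inner ℝ (latticePoint C k) ξ) : ℂ)) *
          conj (∫ ξ, Ψ ξ * (Real.fourierChar (inner ℝ (latticePoint C k) ξ) : ℂ)))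
      (((|C.det|⁻¹ : ℝ) : ℂ) *
        ∑' l : Fin d → ℤ, ∫ ξ, Φ ξ * conj (Ψ (ξ + latticePoint (dualMatrix C) l))) := by
  have hdet : ((|C.det| : ℝ) : ℂ) ≠ 0 := by
    have := ((Matrix.isUnit_iff_isUnit_det C).1 hC).ne_zero
    exact_mod_cast abs_ne_zero.2 this
  have key := hasSum_integral_fourierChar_mul_conj (hΦ.comp (measurable_dualParam C))
    (hΨ.comp (measurable_dualParam C)) (integrable_comp_dualParam hC hΦi)
    (integrable_comp_dualParam hC hΨi) (hΦΦ.correlationFinite hC hΦ hΦ)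
    (hΨΨ.correlationFinite hC hΨ hΨ) (hΦΨ.correlationFinite hC hΦ hΨ)
  have hcoef : ∀ χ : EuclideanSpace ℝ (Fin d) → ℂ, Measurable χ → ∀ k : Fin d → ℤ,
      ∫ η, (χ ∘ dualParam C) η * (Real.fourierChar (∑ i, (k i : ℝ) * η i) : ℂ) =
      (|C.det| : ℝ) * ∫ ξ, χ ξ * (Real.fourierChar (inner ℝ (latticePoint C k) ξ) : ℂ) := by
    intro χ hχ k
    simp only [← inner_latticePoint_dualParam hC, Function.comp_apply]
    exact integral_comp_dualParam hC
      (F := fun ξ => χ ξ * (Real.fourierChar (inner ℝ (latticePoint C k) ξ) : ℂ))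
      (hχ.mul (continuous_fourierChar_inner _).measurable)
  have hcorr : ∀ l : Fin d → ℤ,
      ∫ η, (Φ ∘ dualParam C) η * conj ((Ψ ∘ dualParam C) (η + intVec l)) =
      (|C.det| : ℝ) * ∫ ξ, Φ ξ * conj (Ψ (ξ + latticePoint (dualMatrix C) l)) := by
    intro l
    simp only [Function.comp_apply, dualParam_add, dualParam_intVec]
    exact integral_comp_dualParam hC
      (F := fun ξ => Φ ξ * conj (Ψ (ξ + latticePoint (dualMatrix C) l)))
      (hΦ.mul (Complex.continuous_conj.measurable.comp (hΨ.comp (measurable_add_const _))))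
  simp only [hcoef Φ hΦ, hcoef Ψ hΨ, hcorr, map_mul, Complex.conj_ofReal, tsum_mul_left] at key
  have := key.mul_left (((|C.det|⁻¹ : ℝ) : ℂ) * ((|C.det|⁻¹ : ℝ) : ℂ))
  rw [Complex.ofReal_inv] at this ⊢
  rw [mul_assoc (_)⁻¹, inv_mul_cancel_left₀ hdet] at this
  refine this.congr_fun fun k => ?_
  field_simp

end Lattice

/-! ### Uniqueness for absolutely convergent almost periodic series -/

section AlmostPeriodic

variable {V : Type*} [NormedAddCommGroup V] [InnerProductSpace ℝ V] [FiniteDimensional ℝ V]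
  [MeasurableSpace V] [BorelSpace V]

/-- The prefactor gives the Gaussian total mass one, so this is a weighted mean of a character. As
`b → 0` the mean tends to one at frequency zero and to zero at any other frequency. -/
theorem integral_gaussian_mul_fourierChar {b : ℝ} (hb : 0 < b) (w : V) :
    ((b / Real.pi : ℝ) : ℂ) ^ (Module.finrank ℝ V / 2 : ℂ) *
      ∫ x : V, Complex.exp (-b * ‖x‖ ^ 2) * (Real.fourierChar (inner ℝ w x) : ℂ) =
      (Real.exp (-(Real.pi ^ 2 * ‖w‖ ^ 2) / b) : ℂ) := by
  have h1 : ∀ x : V, Complex.exp (-b * ‖x‖ ^ 2) * (Real.fourierChar (inner ℝ w x) : ℂ) =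
      Complex.exp (-b * ‖x‖ ^ 2 + (2 * Real.pi * Complex.I) * (inner ℝ w x : ℝ)) := by
    intro x
    rw [Real.fourierChar_apply, ← Complex.exp_add]
    congr 2
    push_cast
    ring
  simp only [h1]
  rw [GaussianFourier.integral_cexp_neg_mul_sq_norm_add (by simpa using hb), ← mul_assoc,
    ← Complex.ofReal_div, ← Complex.mul_cpow_ofReal_nonneg (by positivity) (by positivity),
    ← Complex.ofReal_mul]
  have h2 : b / Real.pi * (Real.pi / b) = 1 := by
    have := Real.pi_ne_zero
    field_simp
  rw [h2, Complex.ofReal_one, Complex.one_cpow, one_mul, Complex.ofReal_exp]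
  congr 1
  push_cast
  have hb' : (b : ℂ) ≠ 0 := by exact_mod_cast hb.ne'
  rw [mul_pow, mul_pow, Complex.I_sq]
  field_simp
  ring

theorem tendsto_exp_neg_div_nhdsGT (a : ℝ) (ha : 0 ≤ a) :
    Filter.Tendsto (fun b : ℝ => (Real.exp (-a / b) : ℂ)) (𝓝[>] 0)
      (𝓝 (if a = 0 then 1 else 0)) := by
  split_ifs with h
  · subst h
    simp only [neg_zero, zero_div, Real.exp_zero, Complex.ofReal_one]
    exact tendsto_const_nhds
  · rw [← Complex.ofReal_zero]
    refine (Complex.continuous_ofReal.tendsto 0).comp (Real.tendsto_exp_atBot.comp ?_)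
    exact tendsto_inv_nhdsGT_zero.const_mul_atTop_of_neg
      (neg_lt_zero.2 (lt_of_le_of_ne ha (Ne.symm h)))

/-- If an absolutely convergent series of characters is constant, then its coefficients, collected
by frequency, vanish at all nonzero frequencies. -/
theorem tsum_coeff_eq_zero_of_hasSum_const {ι : Type*} [Countable ι] {c : ι → ℂ} {β : ι → V}
    (hc : Summable fun j => ‖c j‖)
    {a : ℂ} (h : ∀ x : V, HasSum (fun j => c j * (Real.fourierChar (inner ℝ (β j) x) : ℂ)) a)
    {α : V} (hα : α ≠ 0) :
    ∑' j, Set.indicator {j | β j = α} c j = 0 := by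
  -- The series is multiplied by the character of `-α`, moving frequency `α` to zero, and averaged
  -- against the Gaussian term by term.
  have hG : ∀ b : ℝ, 0 < b →
      ∑' j, c j * (Real.exp (-(Real.pi ^ 2 * ‖β j - α‖ ^ 2) / b) : ℂ) =
        a * (Real.exp (-(Real.pi ^ 2 * ‖-α‖ ^ 2) / b) : ℂ) := by
    intro b hb
    have hint : Integrable fun x : V => Complex.exp (-b * ‖x‖ ^ 2) := by
      simpa using GaussianFourier.integrable_cexp_neg_mul_sq_norm_add (V := V) (b := b)
        (by simpa using hb) 0 0
    have hcont : ∀ w : V, Continuous fun x : V => (Real.fourierChar (inner ℝ w x) : ℂ) := fun w =>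
      continuous_subtype_val.comp (Real.continuous_fourierChar.comp (by fun_prop))
    have hint2 : ∀ w : V, Integrable fun x : V =>
        Complex.exp (-b * ‖x‖ ^ 2) * (Real.fourierChar (inner ℝ w x) : ℂ) := fun w =>
      hint.mul_bdd (c := 1) (hcont w).aestronglyMeasurable
        (Filter.Eventually.of_forall fun x => (Circle.norm_coe _).le)
    have h1 := hasSum_integral_of_summable_integral_norm (μ := volume)
      (F := fun (j : ι) (x : V) => c j *
        (Complex.exp (-b * ‖x‖ ^ 2) * (Real.fourierChar (inner ℝ (β j - α) x) : ℂ)))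
      (fun j => (hint2 _).const_mul _) (by
        simp only [norm_mul, Circle.norm_coe, mul_one]
        simp only [integral_const_mul]
        exact hc.mul_right _)
    have h2 : ∫ x : V, ∑' j, c j *
        (Complex.exp (-b * ‖x‖ ^ 2) * (Real.fourierChar (inner ℝ (β j - α) x) : ℂ)) =
        a * ∫ x : V, Complex.exp (-b * ‖x‖ ^ 2) * (Real.fourierChar (inner ℝ (-α) x) : ℂ) := by
      rw [← integral_const_mul]
      refine integral_congr_ae (Filter.Eventually.of_forall fun x => ?_)
      have h3 := (h x).mul_right
        (Complex.exp (-b * ‖x‖ ^ 2) * (Real.fourierChar (inner ℝ (-α) x) : ℂ))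
      refine Eq.trans (tsum_congr fun j => ?_) h3.tsum_eq
      rw [sub_eq_add_neg, inner_add_left, AddChar.map_add_eq_mul, Circle.coe_mul]
      ring
    rw [h2] at h1
    have h4 := (h1.mul_left (((b / Real.pi : ℝ) : ℂ) ^ (Module.finrank ℝ V / 2 : ℂ))).tsum_eq
    rw [mul_left_comm, integral_gaussian_mul_fourierChar hb] at h4
    refine Eq.trans (tsum_congr fun j => ?_) h4
    rw [integral_const_mul, mul_left_comm, integral_gaussian_mul_fourierChar hb]
  have hlim : Filter.Tendsto
      (fun b : ℝ => ∑' j, c j * (Real.exp (-(Real.pi ^ 2 * ‖β j - α‖ ^ 2) / b) : ℂ)) (𝓝[>] 0)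
      (𝓝 (∑' j, c j * (if Real.pi ^ 2 * ‖β j - α‖ ^ 2 = 0 then 1 else 0))) := by
    refine tendsto_tsum_of_dominated_convergence hc
      (fun j => (tendsto_exp_neg_div_nhdsGT _ (by positivity)).const_mul _) ?_
    filter_upwards [self_mem_nhdsWithin] with b hb j
    rw [norm_mul, Complex.norm_real, Real.norm_of_nonneg (Real.exp_pos _).le]
    refine mul_le_of_le_one_right (norm_nonneg _) (Real.exp_le_one_iff.2 ?_)
    exact div_nonpos_of_nonpos_of_nonneg (neg_nonpos.2 (by positivity)) (le_of_lt hb)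
  -- The constant sits at frequency `-α ≠ 0` after the shift, so its mean tends to zero.
  have hzero : Filter.Tendsto
      (fun b : ℝ => ∑' j, c j * (Real.exp (-(Real.pi ^ 2 * ‖β j - α‖ ^ 2) / b) : ℂ)) (𝓝[>] 0)
      (𝓝 0) := by
    have h1 := (tendsto_exp_neg_div_nhdsGT (Real.pi ^ 2 * ‖-α‖ ^ 2) (by positivity)).const_mul a
    rw [if_neg (by simp [hα, Real.pi_ne_zero]), mul_zero] at h1
    refine h1.congr' ?_
    filter_upwards [self_mem_nhdsWithin] with b hb
    exact (hG b hb).symm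
  rw [← tendsto_nhds_unique hlim hzero]
  refine tsum_congr fun j => ?_
  by_cases hj : β j = α
  · rw [Set.indicator_of_mem (show j ∈ {j | β j = α} from hj), hj]
    simp
  · rw [Set.indicator_of_notMem (show j ∉ {j | β j = α} from hj), if_neg, mul_zero]
    simp [sub_eq_zero, hj, Real.pi_ne_zero]

end AlmostPeriodic

/-! ### The local integrability condition on sets of finite measure -/

section LocalIntegrability

variable {d : ℕ}

theorem summable_of_tsum_enorm_lt_top {ι E : Type*} [NormedAddCommGroup E] {c : ι → E}
    (h : ∑' j, ‖c j‖ₑ < ⊤) : Summable fun j => ‖c j‖ := by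
  have h1 : Summable fun j => ‖c j‖₊ := by
    rw [← ENNReal.tsum_coe_ne_top_iff_summable]
    simpa only [enorm_eq_nnnorm] using h.ne
  simpa using NNReal.summable_coe.2 h1

theorem ENNReal.mul_le_sq_add_sq (a b : ℝ≥0∞) : a * b ≤ a ^ 2 + b ^ 2 := by
  rcases le_total a b with h | h
  · exact (mul_le_mul_left h b).trans ((sq b).symm.le.trans le_add_self)
  · exact (mul_le_mul_right h a).trans ((sq a).symm.le.trans le_self_add)

theorem isClosed_essSupport (φ : EuclideanSpace ℝ (Fin d) → ℂ) : IsClosed (essSupport φ) := by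
  rw [← isOpen_compl_iff, isOpen_iff_mem_nhds]
  intro ξ hξ
  simp only [essSupport, Set.mem_compl_iff, Set.mem_ofPred_eq, not_forall, not_not] at hξ
  obtain ⟨U, hU, h0⟩ := hξ
  filter_upwards [eventually_mem_nhds_iff.2 hU] with ζ hζ
  simp only [essSupport, Set.mem_compl_iff, Set.mem_ofPred_eq, not_forall, not_not]
  exact ⟨U, hζ, h0⟩

/-- Every point off the support has a neighbourhood on which `φ` vanishes almost everywhere, and a
locally null set is null. -/
theorem ae_eq_zero_of_notMem_essSupport (φ : EuclideanSpace ℝ (Fin d) → ℂ) :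
    ∀ᵐ ξ, ξ ∉ essSupport φ → φ ξ = 0 := by
  rw [ae_iff]
  refine measure_null_of_locally_null _ fun ξ hξ => ?_
  simp only [Set.mem_ofPred_eq, Classical.not_imp] at hξ
  obtain ⟨hξ, -⟩ := hξ
  simp only [essSupport, Set.mem_ofPred_eq, not_forall, not_not] at hξ
  obtain ⟨U, hU, h0⟩ := hξ
  have h1 : φ =ᵐ[volume.restrict (interior U)] 0 :=
    ae_mono (Measure.restrict_mono interior_subset le_rfl) h0
  have h2 := (ae_restrict_iff' isOpen_interior.measurableSet).1 h1
  rw [ae_iff] at h2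
  refine ⟨_, Filter.inter_mem (mem_nhdsWithin_of_mem_nhds (interior_mem_nhds.2 hU))
    self_mem_nhdsWithin, measure_mono_null ?_ h2⟩
  rintro ζ ⟨hζ, hζ'⟩
  simp only [Set.mem_ofPred_eq, Classical.not_imp] at hζ' ⊢
  exact ⟨hζ, hζ'.2⟩

/-- The local integrability sum for a function whose Fourier transform is the indicator function
of `K`. -/
def LocallyFiniteOn {P : Type*} (C : P → Matrix (Fin d) (Fin d) ℝ) (g : P → L2Space d)
    (K : Set (EuclideanSpace ℝ (Fin d))) : Prop :=
  ∑' (p : P) (k : Fin d → ℤ), ∫⁻ ξ in K,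
    K.indicator 1 (ξ + latticePoint (dualMatrix (C p)) k) *
      ENNReal.ofReal |(C p).det|⁻¹ * ‖(𝓕 (g p) : L2Space d) ξ‖ₑ ^ 2 < ⊤

variable {P : Type*} {C : P → Matrix (Fin d) (Fin d) ℝ} {g h : P → L2Space d}

/-- The condition is tested on the function whose Fourier transform is the indicator of `K`. -/
theorem LocallyIntegrableSystem.locallyFiniteOn (hg : LocallyIntegrableSystem C g)
    {K : Set (EuclideanSpace ℝ (Fin d))} (hK : IsCompact K) (h0 : 0 ∉ K) :
    LocallyFiniteOn C g K := by
  set u : L2Space d := indicatorConstLp 2 hK.measurableSet hK.measure_lt_top.ne (1 : ℂ) with hu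
  have huc : u =ᵐ[volume] K.indicator fun _ => (1 : ℂ) := indicatorConstLp_coeFn
  set f : L2Space d := 𝓕⁻ u with hf
  have hfu : (𝓕 f : L2Space d) = u := FourierTransform.fourier_fourierInv_eq u
  have hsub : essSupport (u : EuclideanSpace ℝ (Fin d) → ℂ) ⊆ K := by
    intro ξ hξ
    by_contra hn
    refine hξ Kᶜ (hK.isClosed.isOpen_compl.mem_nhds hn) ?_
    filter_upwards [ae_restrict_of_ae huc, ae_restrict_mem hK.measurableSet.compl] with ζ h1 h2
    rw [h1, Set.indicator_of_notMem h2, Pi.zero_apply]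
  have hmem : f ∈ testSpace d := by
    refine ⟨?_, ?_, ?_⟩
    · rw [hfu]
      exact (memLp_congr_ae huc).2 (memLp_indicator_const ⊤ hK.measurableSet 1
        (Or.inr hK.measure_lt_top.ne))
    · rw [hfu]
      exact hK.of_isClosed_subset (isClosed_essSupport _) hsub
    · rw [hfu]
      exact fun h => h0 (hsub h)
  refine lt_of_le_of_lt ?_ (hg f hmem)
  rw [hfu]
  refine ENNReal.tsum_le_tsum fun p => ENNReal.tsum_le_tsum fun k => ?_
  set α := latticePoint (dualMatrix (C p)) k
  -- The support can be smaller than `K`, but only by a null set.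
  have hle : K ≤ᵐ[volume] essSupport (u : EuclideanSpace ℝ (Fin d) → ℂ) := by
    filter_upwards [huc, ae_eq_zero_of_notMem_essSupport (u : EuclideanSpace ℝ (Fin d) → ℂ)]
      with ξ h1 h2 h3
    by_contra hn
    rw [h2 hn, Set.indicator_of_mem h3] at h1
    exact zero_ne_one h1
  refine (lintegral_mono_set' hle).trans (lintegral_mono_ae (ae_restrict_of_ae ?_))
  have hshift := (measurePreserving_add_right (volume : Measure (EuclideanSpace ℝ (Fin d)))
    α).quasiMeasurePreserving.ae huc
  filter_upwards [hshift] with ξ h1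
  rw [h1]
  gcongr
  by_cases hξ : ξ + α ∈ K <;> simp [hξ]

/-- In dimension zero the origin is the whole space, so `testSpace` contains only zero and local
integrability says nothing. The Bessel sum for the function with transform `1` is the required sum.
-/
theorem locallyFiniteOn_univ_of_isBessel {P : Type*} {C : P → Matrix (Fin 0) (Fin 0) ℝ}
    {g : P → L2Space 0} (hg : IsBessel (translationSystem C g)) :
    LocallyFiniteOn C g Set.univ := by
  have hvol : (volume : Measure (EuclideanSpace ℝ (Fin 0))) Set.univ = 1 := by
    rw [← (PiLp.volume_preserving_toLp (Fin 0)).measure_preimage MeasurableSet.univ.nullMeasurableSet]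
    simp [volume_pi]
  set u : L2Space 0 := indicatorConstLp 2 MeasurableSet.univ (by rw [hvol]; simp) (1 : ℂ) with hu
  have huc : u =ᵐ[volume] Set.univ.indicator fun _ => (1 : ℂ) := indicatorConstLp_coeFn
  set f : L2Space 0 := 𝓕⁻ u with hf
  have hfu : (𝓕 f : L2Space 0) = u := FourierTransform.fourier_fourierInv_eq u
  obtain ⟨M, hM⟩ := hg
  refine lt_of_le_of_lt ?_ ((hM f).trans_lt (ENNReal.mul_lt_top ENNReal.coe_lt_top (by simp)))
  rw [← ENNReal.tsum_prod]
  refine ENNReal.tsum_le_tsum fun pk => le_of_eq ?_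
  have h1 : (inner ℂ (translationSystem C g pk) f : ℂ) =
      conj ((𝓕 (g pk.1) : L2Space 0) 0) := by
    rw [translationSystem, inner_translationOp, hfu]
    have : ∫ ξ, u ξ * conj ((𝓕 (g pk.1) : L2Space 0) ξ) *
        (Real.fourierChar (inner ℝ (latticePoint (C pk.1) pk.2) ξ) : ℂ) =
        ∫ ξ : EuclideanSpace ℝ (Fin 0), conj ((𝓕 (g pk.1) : L2Space 0) 0) := by
      refine integral_congr_ae ?_
      filter_upwards [huc] with ξ h1
      rw [h1, Subsingleton.elim ξ 0]
      simp
    rw [this]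
    simp [Measure.real, hvol]
  have h2 : ∀ ξ, (𝓕 (g pk.1) : L2Space 0) ξ = (𝓕 (g pk.1) : L2Space 0) 0 := fun ξ => by
    rw [Subsingleton.elim ξ 0]
  rw [h1, lintegral_congr fun ξ => by rw [h2 ξ]]
  simp [hvol]

/-- Sets of finite measure that exhaust the frequency space up to a null set and on which the
local integrability sums are finite. -/
theorem exists_exhaustion (hgB : IsBessel (translationSystem C g))
    (hhB : IsBessel (translationSystem C h))
    (hgL : LocallyIntegrableSystem C g) (hhL : LocallyIntegrableSystem C h) :
    ∃ K : ℕ → Set (EuclideanSpace ℝ (Fin d)), Monotone K ∧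
      (∀ n, MeasurableSet (K n) ∧ volume (K n) < ⊤ ∧ LocallyFiniteOn C g (K n) ∧
        LocallyFiniteOn C h (K n)) ∧ ∀ᵐ ξ, ∃ n, ξ ∈ K n := by
  rcases Nat.eq_zero_or_pos d with rfl | hd
  · refine ⟨fun _ => Set.univ, monotone_const, fun n => ⟨MeasurableSet.univ, ?_,
      locallyFiniteOn_univ_of_isBessel hgB, locallyFiniteOn_univ_of_isBessel hhB⟩, by simp⟩
    exact isCompact_univ.measure_lt_top
  · have : Nonempty (Fin d) := ⟨⟨0, hd⟩⟩
    have hK : ∀ n : ℕ, IsCompact (Metric.closedBall (0 : EuclideanSpace ℝ (Fin d)) (n + 1) \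
        Metric.ball 0 (1 / (n + 1))) := fun n =>
      (isCompact_closedBall _ _).diff Metric.isOpen_ball
    have h0 : ∀ n : ℕ, (0 : EuclideanSpace ℝ (Fin d)) ∉
        Metric.closedBall (0 : EuclideanSpace ℝ (Fin d)) (n + 1) \
        Metric.ball 0 (1 / ((n : ℝ) + 1)) := fun n hn =>
      hn.2 (Metric.mem_ball_self (by positivity))
    -- Closed annuli are compact, avoid the origin and cover everything else; the origin is null
    -- because `d > 0`.
    refine ⟨fun n => Metric.closedBall 0 (n + 1) \ Metric.ball 0 (1 / ((n : ℝ) + 1)), ?_,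
      fun n => ⟨(hK n).measurableSet, (hK n).measure_lt_top, hgL.locallyFiniteOn (hK n) (h0 n),
        hhL.locallyFiniteOn (hK n) (h0 n)⟩, ?_⟩
    · intro m n hmn
      have hmn' : (m : ℝ) ≤ n := Nat.cast_le.2 hmn
      exact Set.sdiff_subset_sdiff (Metric.closedBall_subset_closedBall (by linarith))
        (Metric.ball_subset_ball (by gcongr))
    · have hne : ∀ᵐ ξ : EuclideanSpace ℝ (Fin d), ξ ≠ 0 := by
        rw [ae_iff]
        simp
      filter_upwards [hne] with ξ hξ
      obtain ⟨n, hn⟩ := exists_nat_gt (max ‖ξ‖ (1 / ‖ξ‖))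
      have hpos : 0 < ‖ξ‖ := norm_pos_iff.2 hξ
      have h1 := (le_max_left ‖ξ‖ (1 / ‖ξ‖)).trans_lt hn
      have h2 := (le_max_right ‖ξ‖ (1 / ‖ξ‖)).trans_lt hn
      refine ⟨n, ?_, ?_⟩
      · rw [mem_closedBall_zero_iff]
        linarith
      · rw [mem_ball_zero_iff, not_lt, div_le_iff₀ (by positivity)]
        rw [div_lt_iff₀ hpos] at h2
        nlinarith

theorem latticePoint_neg (A : Matrix (Fin d) (Fin d) ℝ) (k : Fin d → ℤ) :
    latticePoint A (-k) = -latticePoint A k := by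
  have : (fun i => (((-k) i : ℤ) : ℝ)) = -fun i => (k i : ℝ) := by
    ext i
    simp
  simp only [latticePoint, this, Matrix.mulVec_neg, WithLp.toLp_neg]

theorem latticePoint_zero (A : Matrix (Fin d) (Fin d) ℝ) : latticePoint A 0 = 0 := by
  have : (fun i => (((0 : Fin d → ℤ) i : ℤ) : ℝ)) = 0 := by
    ext i
    simp
  simp only [latticePoint, this, Matrix.mulVec_zero, WithLp.toLp_zero]

/-- `f` has an essentially bounded Fourier transform that vanishes off `K`. -/
def IsBandLimited (K : Set (EuclideanSpace ℝ (Fin d))) (f : L2Space d) : Prop :=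
  ∃ B : ℝ≥0, ∀ᵐ ξ, ‖(𝓕 f : L2Space d) ξ‖ₑ ≤ K.indicator (fun _ => (B : ℝ≥0∞)) ξ

theorem IsBandLimited.mono {K L : Set (EuclideanSpace ℝ (Fin d))} {f : L2Space d}
    (hf : IsBandLimited K f) (hKL : K ⊆ L) : IsBandLimited L f := by
  obtain ⟨B, hB⟩ := hf
  exact ⟨B, hB.mono fun ξ hξ => hξ.trans
    (Set.indicator_le_indicator_of_subset hKL (fun _ => zero_le) ξ)⟩

theorem exists_isBandLimited {K : Set (EuclideanSpace ℝ (Fin d))} (hK : MeasurableSet K)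
    (hKv : volume K < ⊤) {u : EuclideanSpace ℝ (Fin d) → ℂ} (hu : Measurable u) (B : ℝ≥0)
    (huB : ∀ ξ, ‖u ξ‖ₑ ≤ K.indicator (fun _ => (B : ℝ≥0∞)) ξ) :
    ∃ f : L2Space d, IsBandLimited K f ∧ (𝓕 f : L2Space d) =ᵐ[volume] u := by
  have hmem : MemLp u 2 volume := by
    refine (memLp_indicator_const 2 hK ((B : ℝ) : ℂ) (Or.inr hKv.ne)).of_le
      hu.aestronglyMeasurable (Filter.Eventually.of_forall fun ξ =>
        enorm_le_iff_norm_le.1 ((huB ξ).trans (le_of_eq ?_)))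
    by_cases hξ : ξ ∈ K
    · rw [Set.indicator_of_mem hξ, Set.indicator_of_mem hξ, enorm_eq_nnnorm]
      congr 1
      ext
      simp
    · simp [hξ]
  have hc : (𝓕 (𝓕⁻ (hmem.toLp u) : L2Space d) : L2Space d) =ᵐ[volume] u := by
    rw [FourierTransform.fourier_fourierInv_eq]
    exact hmem.coeFn_toLp
  refine ⟨𝓕⁻ (hmem.toLp u), ⟨B, ?_⟩, hc⟩
  filter_upwards [hc] with ξ hξ
  rw [hξ]
  exact huB ξ

/-- The bounds on `𝓕 f₁` and `𝓕 f₂` confine `ξ` and `ξ + α` to `K`, and `ab ≤ a² + b²` separates `h`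
from `g`. The `h` part is a local integrability term; translating by `α` makes the `g` part one with
index `-l`, and negation permutes the lattice. -/
theorem LocallyFiniteOn.correlation_lt_top {K : Set (EuclideanSpace ℝ (Fin d))}
    (hK : MeasurableSet K) (hg : LocallyFiniteOn C g K) (hh : LocallyFiniteOn C h K)
    {f₁ f₂ : L2Space d} (hf₁ : IsBandLimited K f₁) (hf₂ : IsBandLimited K f₂) :
    ∑' (p : P) (l : Fin d → ℤ), ENNReal.ofReal |(C p).det|⁻¹ *
      ∫⁻ ξ, (‖(𝓕 f₁ : L2Space d) ξ‖ₑ * ‖(𝓕 (h p) : L2Space d) ξ‖ₑ) *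
        (‖(𝓕 f₂ : L2Space d) (ξ + latticePoint (dualMatrix (C p)) l)‖ₑ *
          ‖(𝓕 (g p) : L2Space d) (ξ + latticePoint (dualMatrix (C p)) l)‖ₑ) < ⊤ := by
  obtain ⟨B₁, hB₁⟩ := hf₁
  obtain ⟨B₂, hB₂⟩ := hf₂
  have hK1 : Measurable (K.indicator (1 : EuclideanSpace ℝ (Fin d) → ℝ≥0∞)) :=
    measurable_one.indicator hK
  have hmg : ∀ p, Measurable fun ξ => ‖(𝓕 (g p) : L2Space d) ξ‖ₑ ^ 2 := fun p =>
    ((Lp.stronglyMeasurable _).measurable.enorm).pow_const 2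
  have hmh : ∀ p, Measurable fun ξ => ‖(𝓕 (h p) : L2Space d) ξ‖ₑ ^ 2 := fun p =>
    ((Lp.stronglyMeasurable _).measurable.enorm).pow_const 2
  set G : P → (Fin d → ℤ) → ℝ≥0∞ := fun p l => ∫⁻ ξ in K,
    K.indicator 1 (ξ + latticePoint (dualMatrix (C p)) l) *
      ENNReal.ofReal |(C p).det|⁻¹ * ‖(𝓕 (g p) : L2Space d) ξ‖ₑ ^ 2 with hG
  set H : P → (Fin d → ℤ) → ℝ≥0∞ := fun p l => ∫⁻ ξ in K,
    K.indicator 1 (ξ + latticePoint (dualMatrix (C p)) l) *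
      ENNReal.ofReal |(C p).det|⁻¹ * ‖(𝓕 (h p) : L2Space d) ξ‖ₑ ^ 2 with hH
  have hterm : ∀ p l, ENNReal.ofReal |(C p).det|⁻¹ *
      ∫⁻ ξ, (‖(𝓕 f₁ : L2Space d) ξ‖ₑ * ‖(𝓕 (h p) : L2Space d) ξ‖ₑ) *
        (‖(𝓕 f₂ : L2Space d) (ξ + latticePoint (dualMatrix (C p)) l)‖ₑ *
          ‖(𝓕 (g p) : L2Space d) (ξ + latticePoint (dualMatrix (C p)) l)‖ₑ) ≤
      (B₁ * B₂ : ℝ≥0∞) * (H p l + G p (-l)) := by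
    intro p l
    set α := latticePoint (dualMatrix (C p)) l with hα
    set D := ENNReal.ofReal |(C p).det|⁻¹ with hD
    have hmα : Measurable fun ξ : EuclideanSpace ℝ (Fin d) => ξ + α := measurable_add_const α
    have hH' : H p l = ∫⁻ ξ, K.indicator 1 ξ * (K.indicator 1 (ξ + α) * D *
        ‖(𝓕 (h p) : L2Space d) ξ‖ₑ ^ 2) := by
      simp only [hH]
      rw [← lintegral_indicator hK]
      refine lintegral_congr fun ξ => ?_
      by_cases hξ : ξ ∈ K <;> simp [hξ, ← hα, ← hD]
    have hG' : G p (-l) = ∫⁻ ξ, K.indicator 1 ξ * (K.indicator 1 (ξ + α) * D *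
        ‖(𝓕 (g p) : L2Space d) (ξ + α)‖ₑ ^ 2) := by
      simp only [hG]
      rw [← lintegral_indicator hK, ← lintegral_add_right_eq_self _ α]
      refine lintegral_congr fun ξ => ?_
      rw [latticePoint_neg, ← hα, ← hD]
      by_cases hξ : ξ ∈ K <;> by_cases hξ' : ξ + α ∈ K <;> simp [hξ, hξ']
    have hmH : Measurable fun ξ => K.indicator 1 ξ * (K.indicator 1 (ξ + α) * D *
        ‖(𝓕 (h p) : L2Space d) ξ‖ₑ ^ 2) :=
      hK1.mul (((hK1.comp hmα).mul_const _).mul (hmh p))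
    rw [hH', hG', ← lintegral_add_left hmH, ← lintegral_const_mul' _ _ ENNReal.ofReal_ne_top,
      ← lintegral_const_mul' _ _ (ENNReal.mul_ne_top ENNReal.coe_ne_top ENNReal.coe_ne_top)]
    have hB₂' := (measurePreserving_add_right (volume : Measure (EuclideanSpace ℝ (Fin d)))
      α).quasiMeasurePreserving.ae hB₂
    refine lintegral_mono_ae ?_
    filter_upwards [hB₁, hB₂'] with ξ h1 h2
    by_cases hξ : ξ ∈ K
    · by_cases hξ' : ξ + α ∈ K
      · rw [Set.indicator_of_mem hξ] at h1
        rw [Set.indicator_of_mem hξ'] at h2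
        simp only [Set.indicator_of_mem hξ, Set.indicator_of_mem hξ', Pi.one_apply, one_mul]
        calc D * ((‖(𝓕 f₁ : L2Space d) ξ‖ₑ * ‖(𝓕 (h p) : L2Space d) ξ‖ₑ) *
              (‖(𝓕 f₂ : L2Space d) (ξ + α)‖ₑ * ‖(𝓕 (g p) : L2Space d) (ξ + α)‖ₑ))
            ≤ D * ((B₁ * ‖(𝓕 (h p) : L2Space d) ξ‖ₑ) *
              (B₂ * ‖(𝓕 (g p) : L2Space d) (ξ + α)‖ₑ)) := by gcongr
          _ = (B₁ * B₂) * (D * (‖(𝓕 (h p) : L2Space d) ξ‖ₑ *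
              ‖(𝓕 (g p) : L2Space d) (ξ + α)‖ₑ)) := by ring
          _ ≤ (B₁ * B₂) * (D * (‖(𝓕 (h p) : L2Space d) ξ‖ₑ ^ 2 +
              ‖(𝓕 (g p) : L2Space d) (ξ + α)‖ₑ ^ 2)) := by
            gcongr
            exact ENNReal.mul_le_sq_add_sq _ _
          _ = _ := by ring
      · rw [Set.indicator_of_notMem hξ', nonpos_iff_eq_zero] at h2
        simp [h2]
    · rw [Set.indicator_of_notMem hξ, nonpos_iff_eq_zero] at h1
      simp [h1]
  refine lt_of_le_of_lt (ENNReal.tsum_le_tsum fun p => ENNReal.tsum_le_tsum (hterm p)) ?_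
  have hneg : ∀ p, ∑' l, G p (-l) = ∑' l, G p l := fun p =>
    (Equiv.neg (Fin d → ℤ)).tsum_eq (G p)
  simp only [ENNReal.tsum_mul_left, ENNReal.tsum_add, hneg]
  exact ENNReal.mul_lt_top (ENNReal.mul_lt_top ENNReal.coe_lt_top ENNReal.coe_lt_top)
    (ENNReal.add_lt_top.2 ⟨hh, hg⟩)

end LocalIntegrability

/-! ### The almost periodic expansion of the mixed dual Gramian -/

section Expansion

variable {d : ℕ}

/-- The product of `𝓕 f`, the conjugate of `𝓕 u` and a character. -/
noncomputable def fourierProduct (x : EuclideanSpace ℝ (Fin d)) (f u : L2Space d)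
    (ξ : EuclideanSpace ℝ (Fin d)) : ℂ :=
  (𝓕 f : L2Space d) ξ * conj ((𝓕 u : L2Space d) ξ) * (Real.fourierChar (-inner ℝ x ξ) : ℂ)

theorem measurable_coeFn (f : L2Space d) : Measurable (f : EuclideanSpace ℝ (Fin d) → ℂ) :=
  (Lp.stronglyMeasurable f).measurable

theorem measurable_fourierProduct (x : EuclideanSpace ℝ (Fin d)) (f u : L2Space d) :
    Measurable (fourierProduct x f u) := by
  refine ((measurable_coeFn _).mul
    (Complex.continuous_conj.measurable.comp (measurable_coeFn _))).mul ?_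
  simp only [← inner_neg_left]
  exact (continuous_fourierChar_inner (-x)).measurable

theorem enorm_fourierProduct (x : EuclideanSpace ℝ (Fin d)) (f u : L2Space d)
    (ξ : EuclideanSpace ℝ (Fin d)) :
    ‖fourierProduct x f u ξ‖ₑ = ‖(𝓕 f : L2Space d) ξ‖ₑ * ‖(𝓕 u : L2Space d) ξ‖ₑ := by
  have : ‖(Real.fourierChar (-inner ℝ x ξ) : ℂ)‖ₑ = 1 := by
    rw [← ofReal_norm, Circle.norm_coe, ENNReal.ofReal_one]
  rw [fourierProduct, enorm_mul, enorm_mul, this, mul_one, RCLike.enorm_conj]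

theorem integrable_fourierProduct (x : EuclideanSpace ℝ (Fin d)) (f u : L2Space d) :
    Integrable (fourierProduct x f u) := by
  have h1 := L2.integrable_inner (𝕜 := ℂ) (𝓕 u : L2Space d) (𝓕 f : L2Space d)
  refine h1.mono (measurable_fourierProduct x f u).aestronglyMeasurable
    (Filter.Eventually.of_forall fun ξ => ?_)
  rw [← enorm_le_iff_norm_le, enorm_fourierProduct, RCLike.inner_apply, enorm_mul,
    RCLike.enorm_conj]

variable {P : Type*} {C : P → Matrix (Fin d) (Fin d) ℝ} {g h : P → L2Space d}
  {K : Set (EuclideanSpace ℝ (Fin d))} {f₁ f₂ : L2Space d}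

theorem LocallyFiniteOn.latticeCorrelationFinite (hC : ∀ p, IsUnit (C p)) (hK : MeasurableSet K)
    (hg : LocallyFiniteOn C g K) (hh : LocallyFiniteOn C h K)
    (hf₁ : IsBandLimited K f₁) (hf₂ : IsBandLimited K f₂) (x : EuclideanSpace ℝ (Fin d)) (p : P) :
    LatticeCorrelationFinite (C p) (fourierProduct x f₁ (h p)) (fourierProduct x f₂ (g p)) := by
  have h1 := (ENNReal.le_tsum p).trans_lt (hg.correlation_lt_top hK hh hf₁ hf₂)
  rw [ENNReal.tsum_mul_left] at h1
  unfold LatticeCorrelationFinite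
  simp only [enorm_fourierProduct]
  refine lt_top_iff_ne_top.2 fun htop => ?_
  rw [htop, ENNReal.mul_top] at h1
  · exact lt_irrefl _ h1
  · have := ((Matrix.isUnit_iff_isUnit_det (C p)).1 (hC p)).ne_zero
    rw [Ne, ENNReal.ofReal_eq_zero, not_le]
    exact inv_pos.2 (abs_pos.2 this)

/-- The frequency `C_p' l`. -/
noncomputable def dualFrequency (C : P → Matrix (Fin d) (Fin d) ℝ) (pl : P × (Fin d → ℤ)) :
    EuclideanSpace ℝ (Fin d) :=
  latticePoint (dualMatrix (C pl.1)) pl.2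

/-- The integrand of the Fourier coefficient of `x ↦ ⟨Θ T_x f₁, T_x f₂⟩` contributed by `p` at the
frequency `α`. -/
noncomputable def gramianIntegrand (C : P → Matrix (Fin d) (Fin d) ℝ) (g h : P → L2Space d)
    (f₁ f₂ : L2Space d)
    (α : EuclideanSpace ℝ (Fin d)) (p : P) (ξ : EuclideanSpace ℝ (Fin d)) : ℂ :=
  (𝓕 f₁ : L2Space d) ξ * conj ((𝓕 f₂ : L2Space d) (ξ + α)) * crossTerm C g h α ξ p

theorem measurable_crossTerm (α : EuclideanSpace ℝ (Fin d)) (p : P) :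
    Measurable fun ξ => crossTerm C g h α ξ p :=
  (measurable_const.mul (Complex.continuous_conj.measurable.comp (measurable_coeFn _))).mul
    ((measurable_coeFn _).comp (measurable_add_const α))

theorem measurable_gramianIntegrand (α : EuclideanSpace ℝ (Fin d)) (p : P) :
    Measurable (gramianIntegrand C g h f₁ f₂ α p) :=
  ((measurable_coeFn _).mul (Complex.continuous_conj.measurable.comp
    ((measurable_coeFn _).comp (measurable_add_const α)))).mul (measurable_crossTerm α p)

theorem enorm_crossTerm (α ξ : EuclideanSpace ℝ (Fin d)) (p : P) :
    ‖crossTerm C g h α ξ p‖ₑ = ENNReal.ofReal |(C p).det|⁻¹ * ‖(𝓕 (h p) : L2Space d) ξ‖ₑ *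
      ‖(𝓕 (g p) : L2Space d) (ξ + α)‖ₑ := by
  rw [crossTerm, enorm_mul, enorm_mul, RCLike.enorm_conj, ← ofReal_norm, Complex.norm_real,
    Real.norm_of_nonneg (inv_nonneg.2 (abs_nonneg _))]

theorem LocallyFiniteOn.tsum_lintegral_gramianIntegrand_lt_top (hK : MeasurableSet K)
    (hg : LocallyFiniteOn C g K) (hh : LocallyFiniteOn C h K)
    (hf₁ : IsBandLimited K f₁) (hf₂ : IsBandLimited K f₂) :
    ∑' pl : P × (Fin d → ℤ),
      ∫⁻ ξ, ‖gramianIntegrand C g h f₁ f₂ (dualFrequency C pl) pl.1 ξ‖ₑ < ⊤ := by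
  refine lt_of_eq_of_lt ?_ (hg.correlation_lt_top hK hh hf₁ hf₂)
  rw [← ENNReal.tsum_prod]
  refine tsum_congr fun pl => ?_
  rw [← lintegral_const_mul' _ _ ENNReal.ofReal_ne_top]
  refine lintegral_congr fun ξ => ?_
  rw [gramianIntegrand, enorm_mul, enorm_mul, RCLike.enorm_conj, enorm_crossTerm, dualFrequency]
  ring

/-- The Fourier coefficient of `x ↦ ⟨Θ T_x f₁, T_x f₂⟩` with index `(p, l)`. -/
noncomputable def gramianCoeff (C : P → Matrix (Fin d) (Fin d) ℝ) (g h : P → L2Space d)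
    (f₁ f₂ : L2Space d)
    (pl : P × (Fin d → ℤ)) : ℂ :=
  ∫ ξ, gramianIntegrand C g h f₁ f₂ (dualFrequency C pl) pl.1 ξ

theorem LocallyFiniteOn.summable_norm_gramianCoeff (hK : MeasurableSet K)
    (hg : LocallyFiniteOn C g K) (hh : LocallyFiniteOn C h K)
    (hf₁ : IsBandLimited K f₁) (hf₂ : IsBandLimited K f₂) :
    Summable fun pl => ‖gramianCoeff C g h f₁ f₂ pl‖ :=
  summable_of_tsum_enorm_lt_top ((ENNReal.tsum_le_tsum fun _ =>
    enorm_integral_le_lintegral_enorm _).trans_lt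
      (hg.tsum_lintegral_gramianIntegrand_lt_top hK hh hf₁ hf₂))

/-- The characters at `ξ` and `ξ + α` combine to the character of `α` at `x`, free of `ξ`, so the
dependence on `x` leaves the integral. -/
theorem inv_det_mul_integral_fourierProduct (x : EuclideanSpace ℝ (Fin d))
    (pl : P × (Fin d → ℤ)) :
    ((|(C pl.1).det|⁻¹ : ℝ) : ℂ) * ∫ ξ, fourierProduct x f₁ (h pl.1) ξ *
      conj (fourierProduct x f₂ (g pl.1) (ξ + latticePoint (dualMatrix (C pl.1)) pl.2)) =
    gramianCoeff C g h f₁ f₂ pl * (Real.fourierChar (inner ℝ (dualFrequency C pl) x) : ℂ) := by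
  rw [gramianCoeff, ← integral_const_mul, ← integral_mul_const]
  congr 1 with ξ
  simp only [fourierProduct, gramianIntegrand, crossTerm, dualFrequency]
  set α := latticePoint (dualMatrix (C pl.1)) pl.2
  have h1 : (Real.fourierChar (-inner ℝ x ξ) : ℂ) *
      conj (Real.fourierChar (-inner ℝ x (ξ + α)) : ℂ) =
      (Real.fourierChar (inner ℝ α x) : ℂ) := by
    rw [← Circle.coe_inv_eq_conj, ← AddChar.map_neg_eq_inv, neg_neg, ← Circle.coe_mul,
      ← AddChar.map_add_eq_mul, inner_add_right, neg_add_cancel_left, real_inner_comm]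
  rw [← h1]
  simp only [map_mul, Complex.conj_conj]
  ring

/-- The absolutely convergent almost periodic expansion of `x ↦ ⟨Θ T_x f₁, T_x f₂⟩`. -/
theorem LocallyFiniteOn.hasSum_inner_mixedGramian (hC : ∀ p, IsUnit (C p))
    (hgB : IsBessel (translationSystem C g)) (hhB : IsBessel (translationSystem C h))
    (hK : MeasurableSet K) (hg : LocallyFiniteOn C g K) (hh : LocallyFiniteOn C h K)
    (hf₁ : IsBandLimited K f₁) (hf₂ : IsBandLimited K f₂) (x : EuclideanSpace ℝ (Fin d)) :
    HasSum (fun pl => gramianCoeff C g h f₁ f₂ pl *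
        (Real.fourierChar (inner ℝ (dualFrequency C pl) x) : ℂ))
      (inner ℂ (translationOp x f₂) (mixedGramian (translationSystem C h) (translationSystem C g)
        hhB hgB (translationOp x f₁)) : ℂ) := by
  have hsum : Summable fun pl => gramianCoeff C g h f₁ f₂ pl *
      (Real.fourierChar (inner ℝ (dualFrequency C pl) x) : ℂ) := by
    refine Summable.of_norm ?_
    simp only [norm_mul, Circle.norm_coe, mul_one]
    exact hg.summable_norm_gramianCoeff hK hh hf₁ hf₂
  have hΘ := (hasSum_mixedGramian hhB hgB (translationOp x f₁)).mapL
    (innerSL ℂ (translationOp x f₂))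
  simp only [innerSL_apply_apply, inner_smul_right] at hΘ
  have hper : ∀ p : P, HasSum (fun k : Fin d → ℤ =>
      (inner ℂ (translationSystem C h (p, k)) (translationOp x f₁) : ℂ) *
        inner ℂ (translationOp x f₂) (translationSystem C g (p, k)))
      (∑' l : Fin d → ℤ, gramianCoeff C g h f₁ f₂ (p, l) *
        (Real.fourierChar (inner ℝ (dualFrequency C (p, l)) x) : ℂ)) := by
    intro p
    -- The two diagonal correlations make the periodizations square integrable; the mixed one makes
    -- their inner product unfold.
    have key := hasSum_lattice_integral_mul_conj (hC p)
      (measurable_fourierProduct x f₁ (h p)) (measurable_fourierProduct x f₂ (g p))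
      (integrable_fourierProduct x f₁ (h p)) (integrable_fourierProduct x f₂ (g p))
      (hh.latticeCorrelationFinite hC hK hh hf₁ hf₁ x p)
      (hg.latticeCorrelationFinite hC hK hg hf₂ hf₂ x p)
      (hg.latticeCorrelationFinite hC hK hh hf₁ hf₂ x p)
    rw [← tsum_mul_left] at key
    have h1 := fun l : Fin d → ℤ => inv_det_mul_integral_fourierProduct (C := C) (g := g) (h := h)
      (f₁ := f₁) (f₂ := f₂) x (p, l)
    simp only [h1] at key
    refine key.congr_fun fun k => ?_
    rw [← inner_conj_symm (translationOp x f₂)]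
    simp only [translationSystem, inner_translationOp_translationOp_fourier]
    rfl
  -- Both double series converge unconditionally and agree after summation over the lattice for each
  -- `p`, so their totals agree.
  rw [(hΘ.prod_fiberwise hper).unique (hsum.hasSum.prod_fiberwise fun p =>
    (hsum.prod_factor p).hasSum)]
  exact hsum.hasSum

end Expansion

/-! ### Collecting the coefficients by frequency -/

section Fibers

variable {d : ℕ} {P : Type*} {C : P → Matrix (Fin d) (Fin d) ℝ} {g h : P → L2Space d}
  {K : Set (EuclideanSpace ℝ (Fin d))} {f₁ f₂ : L2Space d}

/-- Absolute convergence permits summation frequency by frequency, and on each fibre the character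
is a common factor. -/
theorem tsum_mul_fourierChar_eq_of_fibers {ι : Type*} {c : ι → ℂ}
    {β : ι → EuclideanSpace ℝ (Fin d)} (hc : Summable fun j => ‖c j‖)
    (h0 : ∀ α ≠ 0, ∑' j, Set.indicator {j | β j = α} c j = 0) (x : EuclideanSpace ℝ (Fin d)) :
    ∑' j, c j * (Real.fourierChar (inner ℝ (β j) x) : ℂ) =
      ∑' j, Set.indicator {j | β j = 0} c j := by
  have hsum : Summable fun j => c j * (Real.fourierChar (inner ℝ (β j) x) : ℂ) := by
    refine Summable.of_norm ?_
    simpa only [norm_mul, Circle.norm_coe, mul_one] using hc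
  have hfib : ∀ α, ∑' j : {j // β j = α},
      c j * (Real.fourierChar (inner ℝ (β j) x) : ℂ) =
      (∑' j, Set.indicator {j | β j = α} c j) * (Real.fourierChar (inner ℝ α x) : ℂ) := by
    intro α
    rw [← tsum_subtype, ← tsum_mul_right]
    refine tsum_congr fun j => ?_
    rw [j.2]
  refine ((Equiv.sigmaFiberEquiv β).tsum_eq _).symm.trans
    ((((Equiv.sigmaFiberEquiv β).summable_iff.2 hsum).tsum_sigma).trans ?_)
  rw [tsum_eq_single 0]
  · refine (hfib 0).trans ?_
    simp
  · intro α hα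
    refine (hfib α).trans ?_
    rw [h0 α hα, zero_mul]

theorem dualFrequency_eq_iff (hC : ∀ p, IsUnit (C p)) (p : P) (l : Fin d → ℤ)
    (α : EuclideanSpace ℝ (Fin d)) :
    dualFrequency C (p, l) = α ↔ (C p).transpose.mulVec α = fun i => (l i : ℝ) := by
  have hdet : IsUnit (C p).transpose.det := by
    rw [Matrix.det_transpose]
    exact (Matrix.isUnit_iff_isUnit_det (C p)).1 (hC p)
  constructor
  · rintro rfl
    simp only [dualFrequency, latticePoint, dualMatrix]
    rw [Matrix.mulVec_mulVec, Matrix.mul_nonsing_inv _ hdet, Matrix.one_mulVec]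
  · intro hα
    simp only [dualFrequency, latticePoint, dualMatrix]
    rw [← hα, Matrix.mulVec_mulVec, Matrix.nonsing_inv_mul _ hdet, Matrix.one_mulVec]

/-- The pairs `(p, l)` with `C_p' l = α` correspond to the indices in `P_α`. -/
noncomputable def fiberEquiv (hC : ∀ p, IsUnit (C p)) (α : EuclideanSpace ℝ (Fin d)) :
    {pl | dualFrequency C pl = α} ≃ activeIndices C α :=
  Equiv.ofBijective (fun pl => ⟨pl.1.1, pl.1.2, (dualFrequency_eq_iff hC _ _ α).1 pl.2⟩) <| by
    constructor
    · rintro ⟨⟨p, l⟩, hl⟩ ⟨⟨q, m⟩, hm⟩ heq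
      obtain rfl : p = q := congrArg Subtype.val heq
      have hl' := (dualFrequency_eq_iff hC _ _ α).1 hl
      have hm' := (dualFrequency_eq_iff hC _ _ α).1 hm
      have : l = m := by
        ext i
        exact_mod_cast congrFun (hl'.symm.trans hm') i
      subst this
      rfl
    · rintro ⟨p, l, hl⟩
      exact ⟨⟨(p, l), (dualFrequency_eq_iff hC _ _ α).2 hl⟩, rfl⟩

theorem isEmpty_activeIndices (hC : ∀ p, IsUnit (C p)) {α : EuclideanSpace ℝ (Fin d)}
    (hα : α ∉ frequencySet C) : IsEmpty (activeIndices C α) := by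
  refine ⟨?_⟩
  rintro ⟨p, l, hl⟩
  exact hα (Set.mem_iUnion.2 ⟨p, l, (dualFrequency_eq_iff hC p l α).2 hl⟩)

theorem activeIndices_zero : activeIndices C 0 = Set.univ := by
  ext p
  simp only [activeIndices, Set.mem_ofPred_eq, Set.mem_univ, iff_true]
  exact ⟨0, by ext i; simp⟩

/-- The series `∑_{p ∈ P_α} |det C_p|⁻¹ conj(𝓕 h_p(ξ)) 𝓕 g_p(ξ + α)`. -/
noncomputable def crossSum (C : P → Matrix (Fin d) (Fin d) ℝ) (g h : P → L2Space d)
    (α ξ : EuclideanSpace ℝ (Fin d)) : ℂ :=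
  ∑' p : activeIndices C α, crossTerm C g h α ξ p

theorem crossSum_zero (ξ : EuclideanSpace ℝ (Fin d)) :
    crossSum C g h 0 ξ = ∑' p : P, crossTerm C g h 0 ξ p := by
  rw [crossSum, activeIndices_zero]
  exact tsum_univ fun p => crossTerm C g h 0 ξ p

theorem LocallyFiniteOn.tsum_active_lintegral_lt_top (hC : ∀ p, IsUnit (C p))
    (hK : MeasurableSet K) (hg : LocallyFiniteOn C g K) (hh : LocallyFiniteOn C h K)
    (hf₁ : IsBandLimited K f₁) (hf₂ : IsBandLimited K f₂) (α : EuclideanSpace ℝ (Fin d)) :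
    ∑' p : activeIndices C α, ∫⁻ ξ, ‖gramianIntegrand C g h f₁ f₂ α p ξ‖ₑ < ⊤ := by
  rw [← (fiberEquiv hC α).tsum_eq]
  refine lt_of_le_of_lt (le_of_eq_of_le (tsum_congr fun pl => ?_)
    (ENNReal.tsum_comp_le_tsum_of_injective Subtype.val_injective
      fun pl => ∫⁻ ξ, ‖gramianIntegrand C g h f₁ f₂ (dualFrequency C pl) pl.1 ξ‖ₑ))
      (hg.tsum_lintegral_gramianIntegrand_lt_top hK hh hf₁ hf₂)
  rw [pl.2]
  rfl

variable [Countable P]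

theorem measurable_crossSum (α : EuclideanSpace ℝ (Fin d)) : Measurable (crossSum C g h α) :=
  Measurable.tsum fun p => measurable_crossTerm α p.1

/-- The fibre over `α` has one point for each `p ∈ P_α`; absolute convergence brings the sum over
`p` under the integral. -/
theorem LocallyFiniteOn.tsum_indicator_gramianCoeff (hC : ∀ p, IsUnit (C p))
    (hK : MeasurableSet K) (hg : LocallyFiniteOn C g K) (hh : LocallyFiniteOn C h K)
    (hf₁ : IsBandLimited K f₁) (hf₂ : IsBandLimited K f₂) (α : EuclideanSpace ℝ (Fin d)) :
    ∑' pl, Set.indicator {pl | dualFrequency C pl = α} (gramianCoeff C g h f₁ f₂) pl =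
      ∫ ξ, (𝓕 f₁ : L2Space d) ξ * conj ((𝓕 f₂ : L2Space d) (ξ + α)) * crossSum C g h α ξ := by
  rw [← tsum_subtype]
  have h1 : ∀ pl : {pl | dualFrequency C pl = α}, gramianCoeff C g h f₁ f₂ pl =
      ∫ ξ, gramianIntegrand C g h f₁ f₂ α (fiberEquiv hC α pl) ξ := by
    rintro ⟨pl, rfl⟩
    rfl
  have hm : ∀ p : activeIndices C α, Measurable (gramianIntegrand C g h f₁ f₂ α p) := fun p =>
    measurable_gramianIntegrand α p.1
  simp only [h1]
  rw [(fiberEquiv hC α).tsum_eq fun p => ∫ ξ, gramianIntegrand C g h f₁ f₂ α p ξ,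
    ← integral_tsum (fun p => (hm p).aestronglyMeasurable)
      (hg.tsum_active_lintegral_lt_top hC hK hh hf₁ hf₂ α).ne]
  congr 1 with ξ
  simp only [gramianIntegrand, tsum_mul_left, crossSum]

theorem LocallyFiniteOn.integrable_mul_crossSum (hC : ∀ p, IsUnit (C p))
    (hK : MeasurableSet K) (hg : LocallyFiniteOn C g K) (hh : LocallyFiniteOn C h K)
    (hf₁ : IsBandLimited K f₁) (hf₂ : IsBandLimited K f₂) (α : EuclideanSpace ℝ (Fin d)) :
    Integrable fun ξ =>
      (𝓕 f₁ : L2Space d) ξ * conj ((𝓕 f₂ : L2Space d) (ξ + α)) * crossSum C g h α ξ := by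
  refine ⟨(((measurable_coeFn _).mul (Complex.continuous_conj.measurable.comp
    ((measurable_coeFn _).comp (measurable_add_const α)))).mul
      (measurable_crossSum α)).aestronglyMeasurable, ?_⟩
  refine lt_of_le_of_lt ?_ (hg.tsum_active_lintegral_lt_top hC hK hh hf₁ hf₂ α)
  have hm : ∀ p : activeIndices C α, Measurable (gramianIntegrand C g h f₁ f₂ α p) := fun p =>
    measurable_gramianIntegrand α p.1
  rw [← lintegral_tsum fun p => (hm p).enorm.aemeasurable]
  refine lintegral_mono fun ξ => ?_
  have h1 : (𝓕 f₁ : L2Space d) ξ * conj ((𝓕 f₂ : L2Space d) (ξ + α)) * crossSum C g h α ξ =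
      ∑' p : activeIndices C α, gramianIntegrand C g h f₁ f₂ α p ξ := by
    simp only [gramianIntegrand, tsum_mul_left, crossSum]
  exact (congrArg enorm h1).trans_le enorm_tsum_le_tsum_enorm

end Fibers

/-! ### Convergence of the cross terms -/

section Convergence

variable {d : ℕ} {P : Type*} {C : P → Matrix (Fin d) (Fin d) ℝ} {g h : P → L2Space d}

/-- Apply `ab ≤ a² + b²` with the square sum of `h` at `ξ` and that of `g` at `ξ + α`. -/
theorem ae_summable_crossTerm
    (hg : ∀ᵐ ξ, ∑' p, ENNReal.ofReal |(C p).det|⁻¹ * ‖(𝓕 (g p) : L2Space d) ξ‖ₑ ^ 2 < ⊤)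
    (hh : ∀ᵐ ξ, ∑' p, ENNReal.ofReal |(C p).det|⁻¹ * ‖(𝓕 (h p) : L2Space d) ξ‖ₑ ^ 2 < ⊤)
    (α : EuclideanSpace ℝ (Fin d)) : ∀ᵐ ξ, Summable fun p : P => crossTerm C g h α ξ p := by
  have hg' := (measurePreserving_add_right (volume : Measure (EuclideanSpace ℝ (Fin d)))
    α).quasiMeasurePreserving.ae hg
  filter_upwards [hg', hh] with ξ h1 h2
  refine Summable.of_norm (summable_of_tsum_enorm_lt_top ?_)
  refine lt_of_le_of_lt (ENNReal.tsum_le_tsum fun p => ?_)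
    (ENNReal.tsum_add.trans_lt (ENNReal.add_lt_top.2 ⟨h2, h1⟩))
  rw [enorm_crossTerm, mul_assoc, ← mul_add]
  gcongr
  exact ENNReal.mul_le_sq_add_sq _ _

variable [Countable P]

/-- The `k = 0` terms of the local integrability sum alone give the integral over `K` of this
series. -/
theorem LocallyFiniteOn.ae_tsum_enorm_sq_lt_top {K : Set (EuclideanSpace ℝ (Fin d))}
    (hK : MeasurableSet K) (hg : LocallyFiniteOn C g K) :
    ∀ᵐ ξ, ξ ∈ K →
      ∑' p, ENNReal.ofReal |(C p).det|⁻¹ * ‖(𝓕 (g p) : L2Space d) ξ‖ₑ ^ 2 < ⊤ := by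
  have hm : ∀ p, Measurable fun ξ =>
      ENNReal.ofReal |(C p).det|⁻¹ * ‖(𝓕 (g p) : L2Space d) ξ‖ₑ ^ 2 := fun p =>
    ((measurable_coeFn _).enorm.pow_const 2).const_mul _
  have hfin : ∫⁻ ξ in K,
      ∑' p, ENNReal.ofReal |(C p).det|⁻¹ * ‖(𝓕 (g p) : L2Space d) ξ‖ₑ ^ 2 ≠ ⊤ := by
    rw [lintegral_tsum fun p => (hm p).aemeasurable]
    refine (lt_of_le_of_lt (ENNReal.tsum_le_tsum fun p => ?_) hg).ne
    refine le_trans (le_of_eq ?_) (ENNReal.le_tsum (0 : Fin d → ℤ))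
    refine setLIntegral_congr_fun hK fun ξ hξ => ?_
    simp [latticePoint_zero, hξ]
  exact (ae_restrict_iff' hK).1 (ae_lt_top (Measurable.tsum hm) hfin)

theorem ae_tsum_enorm_sq_lt_top_of_exhaustion {K : ℕ → Set (EuclideanSpace ℝ (Fin d))}
    (hK : ∀ n, MeasurableSet (K n)) (hg : ∀ n, LocallyFiniteOn C g (K n))
    (hex : ∀ᵐ ξ, ∃ n, ξ ∈ K n) :
    ∀ᵐ ξ, ∑' p, ENNReal.ofReal |(C p).det|⁻¹ * ‖(𝓕 (g p) : L2Space d) ξ‖ₑ ^ 2 < ⊤ := by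
  filter_upwards [hex, ae_all_iff.2 fun n => (hg n).ae_tsum_enorm_sq_lt_top (hK n)] with ξ h1 h2
  obtain ⟨n, hn⟩ := h1
  exact h2 n hn

end Convergence

/-! ### Band limited functions separate points -/

section Density

variable {d : ℕ} {K : ℕ → Set (EuclideanSpace ℝ (Fin d))}

/-- Cutting `𝓕 v` down to the part of `K n` where its modulus is at most `n` gives the transform of
a band limited function. Its inner product with `v` is the squared norm of the cut-off, and these
parts exhaust the space up to a null set. -/
theorem eq_zero_of_inner_isBandLimited (hK : ∀ n, MeasurableSet (K n))
    (hKv : ∀ n, volume (K n) < ⊤) (hmono : Monotone K) (hex : ∀ᵐ ξ, ∃ n, ξ ∈ K n)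
    {v : L2Space d} (hv : ∀ n f, IsBandLimited (K n) f → (inner ℂ f v : ℂ) = 0) : v = 0 := by
  set w : L2Space d := 𝓕 v with hw
  have hwm : Measurable (w : EuclideanSpace ℝ (Fin d) → ℂ) := measurable_coeFn w
  set A : ℕ → Set (EuclideanSpace ℝ (Fin d)) := fun n => K n ∩ {ξ | ‖w ξ‖ₑ ≤ n} with hA
  have hAm : ∀ n, MeasurableSet (A n) := fun n =>
    (hK n).inter (measurableSet_le hwm.enorm measurable_const)
  have hzero : ∀ n, ∀ᵐ ξ, ξ ∈ A n → w ξ = 0 := by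
    intro n
    obtain ⟨f, hf, hfw⟩ := exists_isBandLimited (hK n) (hKv n) (hwm.indicator (hAm n)) n (by
      intro ξ
      by_cases hξ : ξ ∈ A n
      · rw [Set.indicator_of_mem hξ, Set.indicator_of_mem hξ.1]
        simpa using hξ.2
      · rw [Set.indicator_of_notMem hξ]
        simp)
    have h1 := hv n f hf
    rw [← Lp.inner_fourier_eq, L2.inner_def] at h1
    have h2 : ∫ ξ, (‖(A n).indicator w ξ‖ ^ 2 : ℝ) = 0 := by
      have h3 : ∫ ξ, (inner ℂ ((𝓕 f : L2Space d) ξ) (w ξ) : ℂ) =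
          ∫ ξ, ((‖(A n).indicator w ξ‖ ^ 2 : ℝ) : ℂ) := by
        refine integral_congr_ae ?_
        filter_upwards [hfw] with ξ hξ
        rw [hξ]
        by_cases hξ' : ξ ∈ A n
        · rw [Set.indicator_of_mem hξ', inner_self_eq_norm_sq_to_K]
          push_cast
          rfl
        · simp [Set.indicator_of_notMem hξ']
      rw [h3, integral_complex_ofReal] at h1
      exact_mod_cast h1
    have hint : Integrable fun ξ => ‖(A n).indicator w ξ‖ ^ 2 := by
      have := ((memLp_congr_ae hfw).1 (Lp.memLp _)).integrable_norm_pow (p := 2) (by norm_num)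
      simpa using this
    rw [integral_eq_zero_iff_of_nonneg (fun ξ => by positivity) hint] at h2
    filter_upwards [h2] with ξ h3 h4
    simpa [Set.indicator_of_mem h4] using h3
  have hw0 : w = 0 := by
    refine Lp.ext ?_
    filter_upwards [ae_all_iff.2 hzero, hex, Lp.coeFn_zero ℂ 2
      (volume : Measure (EuclideanSpace ℝ (Fin d)))] with ξ h1 h2 h3
    rw [h3, Pi.zero_apply]
    obtain ⟨n, hn⟩ := h2
    obtain ⟨m, hm⟩ := exists_nat_ge ‖w ξ‖
    refine h1 (max n m) ⟨hmono (le_max_left n m) hn, ?_⟩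
    have h4 : ‖w ξ‖ ≤ ((max n m : ℕ) : ℝ) := hm.trans (Nat.cast_le.2 (le_max_right n m))
    have h5 := ENNReal.ofReal_le_ofReal h4
    rw [ofReal_norm, ENNReal.ofReal_natCast] at h5
    exact h5
  rw [← norm_eq_zero, ← Lp.norm_fourier_eq, ← hw, hw0, norm_zero]

theorem ext_isBandLimited (hK : ∀ n, MeasurableSet (K n))
    (hKv : ∀ n, volume (K n) < ⊤) (hmono : Monotone K) (hex : ∀ᵐ ξ, ∃ n, ξ ∈ K n)
    {F : Type*} [NormedAddCommGroup F] [NormedSpace ℂ F] {S T : L2Space d →L[ℂ] F}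
    (hST : ∀ n f, IsBandLimited (K n) f → S f = T f) : S = T := by
  have hdense : Dense (Submodule.span ℂ {f : L2Space d | ∃ n, IsBandLimited (K n) f} :
      Set (L2Space d)) := by
    rw [Submodule.dense_iff_topologicalClosure_eq_top, Submodule.topologicalClosure_eq_top_iff,
      Submodule.eq_bot_iff]
    intro v hv
    refine eq_zero_of_inner_isBandLimited hK hKv hmono hex fun n f hf => ?_
    exact (Submodule.mem_orthogonal _ v).1 hv f (Submodule.subset_span ⟨n, hf⟩)
  refine ContinuousLinearMap.ext_on hdense ?_
  rintro f ⟨n, hf⟩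
  exact hST n f hf

/-- The formula is extended one argument at a time: first `f₁` by density with `f₂` fixed, then `Θ
f` is identified by testing against all `f₂`. -/
theorem isFourierMultiplier_of_inner (hK : ∀ n, MeasurableSet (K n))
    (hKv : ∀ n, volume (K n) < ⊤) (hmono : Monotone K) (hex : ∀ᵐ ξ, ∃ n, ξ ∈ K n)
    {Θ : L2Space d →L[ℂ] L2Space d} {s : EuclideanSpace ℝ (Fin d) → ℂ} (hs : Measurable s)
    {B : ℝ} (hB : ∀ᵐ ξ, ‖s ξ‖ ≤ B)
    (hΘ : ∀ m n f₁ f₂, IsBandLimited (K m) f₁ → IsBandLimited (K n) f₂ →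
      (inner ℂ f₂ (Θ f₁) : ℂ) =
        ∫ ξ, (𝓕 f₁ : L2Space d) ξ * conj ((𝓕 f₂ : L2Space d) ξ) * s ξ) :
    IsFourierMultiplier Θ s := by
  refine ⟨memLp_top_of_bound hs.aestronglyMeasurable B hB, fun f => ?_⟩
  have hmul : ∀ {t : EuclideanSpace ℝ (Fin d) → ℂ} (_ : Measurable t) (_ : ∀ᵐ ξ, ‖t ξ‖ ≤ B)
      (w : L2Space d), MemLp (fun ξ => t ξ * w ξ) 2 volume := by
    intro t ht htB w
    refine (Lp.memLp w).of_le_mul (c := B) (ht.mul (measurable_coeFn w)).aestronglyMeasurable ?_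
    filter_upwards [htB] with ξ hξ
    rw [norm_mul]
    gcongr
  have hsc : Measurable fun ξ => conj (s ξ) := Complex.continuous_conj.measurable.comp hs
  have hBc : ∀ᵐ ξ, ‖conj (s ξ)‖ ≤ B := by simpa only [RCLike.norm_conj] using hB
  set w : L2Space d := (hmul hs hB (𝓕 f : L2Space d)).toLp _ with hw
  have hwc : w =ᵐ[volume] fun ξ => s ξ * (𝓕 f : L2Space d) ξ :=
    (hmul hs hB (𝓕 f : L2Space d)).coeFn_toLp
  have hall : ∀ n f₂, IsBandLimited (K n) f₂ →
      (inner ℂ f₂ (Θ f) : ℂ) = inner ℂ (𝓕 f₂ : L2Space d) w := by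
    intro n f₂ hf₂
    -- Moving `conj s` onto `𝓕 f₂` exhibits the right-hand side as a bounded functional of `f₁`.
    set v : L2Space d := (hmul hsc hBc (𝓕 f₂ : L2Space d)).toLp _ with hv
    have hvc : v =ᵐ[volume] fun ξ => conj (s ξ) * (𝓕 f₂ : L2Space d) ξ :=
      (hmul hsc hBc (𝓕 f₂ : L2Space d)).coeFn_toLp
    have hclm : (innerSL ℂ f₂) ∘L Θ = (innerSL ℂ v) ∘L
        ((Lp.fourierTransformₗᵢ (EuclideanSpace ℝ (Fin d)) ℂ).toContinuousLinearEquiv :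
          L2Space d →L[ℂ] L2Space d) := by
      refine ext_isBandLimited hK hKv hmono hex fun m f₁ hf₁ => ?_
      refine (hΘ m n f₁ f₂ hf₁ hf₂).trans (Eq.trans ?_
        (L2.inner_def (𝕜 := ℂ) v (𝓕 f₁ : L2Space d)).symm)
      refine integral_congr_ae ?_
      filter_upwards [hvc] with ξ hξ
      rw [hξ, RCLike.inner_apply, map_mul, Complex.conj_conj]
      ring
    refine (DFunLike.congr_fun hclm f).trans
      ((L2.inner_def (𝕜 := ℂ) v (𝓕 f : L2Space d)).trans (Eq.trans ?_
        (L2.inner_def (𝕜 := ℂ) (𝓕 f₂ : L2Space d) w).symm))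
    refine integral_congr_ae ?_
    filter_upwards [hvc, hwc] with ξ h1 h2
    rw [h1, h2, RCLike.inner_apply, RCLike.inner_apply, map_mul, Complex.conj_conj]
    ring
  have h0 : Θ f - 𝓕⁻ w = 0 := by
    refine eq_zero_of_inner_isBandLimited hK hKv hmono hex fun n f₂ hf₂ => ?_
    rw [inner_sub_right, hall n f₂ hf₂, ← Lp.inner_fourier_eq f₂ (𝓕⁻ w),
      FourierTransform.fourier_fourierInv_eq, sub_self]
  rw [sub_eq_zero.1 h0, FourierTransform.fourier_fourierInv_eq]
  exact hwc

end Density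

/-! ### The commutant of the translations -/

section Commutant

variable {d : ℕ} {P : Type*} [Countable P] {C : P → Matrix (Fin d) (Fin d) ℝ} {g h : P → L2Space d}

/-- A function of modulus at most one whose product with `z` is `|z|`. -/
noncomputable def conjPhase (z : ℂ) : ℂ := conj z / (‖z‖ : ℂ)

theorem conjPhase_mul (z : ℂ) : conjPhase z * z = (‖z‖ : ℂ) := by
  rcases eq_or_ne z 0 with rfl | hz
  · simp
  · have : (‖z‖ : ℂ) ≠ 0 := by exact_mod_cast norm_ne_zero_iff.2 hz
    rw [conjPhase, div_mul_eq_mul_div, RCLike.conj_mul, div_eq_iff this, sq]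
    rfl

theorem enorm_conjPhase_le (z : ℂ) : ‖conjPhase z‖ₑ ≤ 1 := by
  have : ‖conjPhase z‖ ≤ 1 := by
    rw [conjPhase, norm_div, RCLike.norm_conj, Complex.norm_real, norm_norm]
    exact div_self_le_one _
  rw [← ofReal_norm]
  exact ENNReal.ofReal_le_one.2 this

theorem measurable_conjPhase : Measurable conjPhase :=
  Complex.continuous_conj.measurable.div (Complex.measurable_ofReal.comp measurable_norm)

theorem mem_centralizer_translationOp_iff {Θ : L2Space d →L[ℂ] L2Space d} :
    Θ ∈ Set.centralizer (Set.range (translationOp (d := d))) ↔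
      ∀ x f, Θ (translationOp x f) = translationOp x (Θ f) := by
  rw [Set.mem_centralizer_iff, Set.forall_mem_range]
  refine forall_congr' fun x => ?_
  rw [ContinuousLinearMap.ext_iff]
  exact forall_congr' fun f => eq_comm

/-- The cross terms vanish if the mixed dual Gramian commutes with translations. -/
theorem LocallyFiniteOn.ae_crossSum_eq_zero (hC : ∀ p, IsUnit (C p))
    (hgB : IsBessel (translationSystem C g)) (hhB : IsBessel (translationSystem C h))
    {K : Set (EuclideanSpace ℝ (Fin d))} (hK : MeasurableSet K) (hKv : volume K < ⊤)
    (hg : LocallyFiniteOn C g K) (hh : LocallyFiniteOn C h K)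
    (hΘ : ∀ x f, mixedGramian (translationSystem C h) (translationSystem C g) hhB hgB
      (translationOp x f) = translationOp x
        (mixedGramian (translationSystem C h) (translationSystem C g) hhB hgB f))
    {α : EuclideanSpace ℝ (Fin d)} (hα : α ≠ 0) :
    ∀ᵐ ξ, ξ ∈ K → ξ + α ∈ K → crossSum C g h α ξ = 0 := by
  -- With `𝓕 f₁` the conjugate phase of the cross sum on `K` and `𝓕 f₂` the indicator of `K`, the
  -- coefficient at `α` is the integral of the modulus over `K ∩ (K - α)`.
  have hu₁ : Measurable (K.indicator fun ξ => conjPhase (crossSum C g h α ξ)) :=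
    (measurable_conjPhase.comp (measurable_crossSum α)).indicator hK
  have hu₂ : Measurable (K.indicator fun _ => (1 : ℂ)) := measurable_const.indicator hK
  obtain ⟨f₁, hf₁, hfu₁⟩ := exists_isBandLimited hK hKv hu₁ 1 (fun ξ => by
    by_cases hξ : ξ ∈ K
    · simpa [hξ] using enorm_conjPhase_le _
    · simp [hξ])
  obtain ⟨f₂, hf₂, hfu₂⟩ := exists_isBandLimited hK hKv hu₂ 1 (fun ξ => by
    by_cases hξ : ξ ∈ K <;> simp [hξ])
  -- Commutation and unitarity of `T_x` make the expanded function constant in `x`.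
  have hS := tsum_coeff_eq_zero_of_hasSum_const
    (hg.summable_norm_gramianCoeff hK hh hf₁ hf₂) (fun x => by
      have := hg.hasSum_inner_mixedGramian hC hgB hhB hK hh hf₁ hf₂ x
      rw [hΘ, inner_translationOp_translationOp] at this
      exact this) hα
  rw [hg.tsum_indicator_gramianCoeff hC hK hh hf₁ hf₂ α] at hS
  have hint := hg.integrable_mul_crossSum hC hK hh hf₁ hf₂ α
  have hshift := (measurePreserving_add_right (volume : Measure (EuclideanSpace ℝ (Fin d)))
    α).quasiMeasurePreserving.ae hfu₂
  set N : EuclideanSpace ℝ (Fin d) → ℝ := (K ∩ (fun ξ => ξ + α) ⁻¹' K).indicator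
    fun ξ => ‖crossSum C g h α ξ‖ with hN
  have heq : (fun ξ => (𝓕 f₁ : L2Space d) ξ * conj ((𝓕 f₂ : L2Space d) (ξ + α)) *
      crossSum C g h α ξ) =ᵐ[volume] fun ξ => (N ξ : ℂ) := by
    filter_upwards [hfu₁, hshift] with ξ h1 h2
    rw [h1, h2, hN]
    by_cases hξ : ξ ∈ K
    · by_cases hξ' : ξ + α ∈ K
      · simp [hξ, hξ', conjPhase_mul]
      · simp [hξ, hξ']
    · simp [hξ]
  rw [integral_congr_ae heq, integral_complex_ofReal] at hS
  have hNi : Integrable N := by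
    have := (hint.congr heq).norm
    refine this.congr (Filter.Eventually.of_forall fun ξ => ?_)
    have h0 : 0 ≤ N ξ := Set.indicator_nonneg (fun _ _ => norm_nonneg _) ξ
    simp [abs_of_nonneg h0]
  have hS' : ∫ ξ, N ξ = 0 := by exact_mod_cast hS
  rw [integral_eq_zero_iff_of_nonneg
    (fun ξ => Set.indicator_nonneg (fun _ _ => norm_nonneg _) ξ) hNi] at hS'
  filter_upwards [hS'] with ξ h1 h2 h3
  simpa [hN, h2, h3] using h1

/-- If the cross terms vanish, then `x ↦ ⟨Θ T_x f₁, T_x f₂⟩` is constant. -/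
theorem LocallyFiniteOn.inner_mixedGramian_eq_integral (hC : ∀ p, IsUnit (C p))
    (hgB : IsBessel (translationSystem C g)) (hhB : IsBessel (translationSystem C h))
    {K : Set (EuclideanSpace ℝ (Fin d))} (hK : MeasurableSet K)
    (hg : LocallyFiniteOn C g K) (hh : LocallyFiniteOn C h K)
    (hcross : ∀ α ∈ frequencySet C \ {0}, ∀ᵐ ξ, crossSum C g h α ξ = 0)
    {f₁ f₂ : L2Space d} (hf₁ : IsBandLimited K f₁) (hf₂ : IsBandLimited K f₂)
    (x : EuclideanSpace ℝ (Fin d)) :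
    (inner ℂ (translationOp x f₂) (mixedGramian (translationSystem C h) (translationSystem C g)
        hhB hgB (translationOp x f₁)) : ℂ) =
      ∫ ξ, (𝓕 f₁ : L2Space d) ξ * conj ((𝓕 f₂ : L2Space d) ξ) * crossSum C g h 0 ξ := by
  rw [← (hg.hasSum_inner_mixedGramian hC hgB hhB hK hh hf₁ hf₂ x).tsum_eq,
    tsum_mul_fourierChar_eq_of_fibers (hg.summable_norm_gramianCoeff hK hh hf₁ hf₂),
    hg.tsum_indicator_gramianCoeff hC hK hh hf₁ hf₂ 0]
  · simp only [add_zero]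
  · intro α hα
    rw [hg.tsum_indicator_gramianCoeff hC hK hh hf₁ hf₂ α]
    refine integral_eq_zero_of_ae ?_
    by_cases hmem : α ∈ frequencySet C
    · filter_upwards [hcross α ⟨hmem, hα⟩] with ξ hξ
      rw [hξ, mul_zero, Pi.zero_apply]
    · have := isEmpty_activeIndices hC hmem
      refine Filter.Eventually.of_forall fun ξ => ?_
      simp [crossSum]

/-- The symbol is bounded by the norm of the mixed dual Gramian. -/
theorem LocallyFiniteOn.ae_enorm_crossSum_zero_le (hC : ∀ p, IsUnit (C p))
    (hgB : IsBessel (translationSystem C g)) (hhB : IsBessel (translationSystem C h))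
    {K : Set (EuclideanSpace ℝ (Fin d))} (hK : MeasurableSet K) (hKv : volume K < ⊤)
    (hg : LocallyFiniteOn C g K) (hh : LocallyFiniteOn C h K)
    (hcross : ∀ α ∈ frequencySet C \ {0}, ∀ᵐ ξ, crossSum C g h α ξ = 0) :
    ∀ᵐ ξ, ξ ∈ K → ‖crossSum C g h 0 ξ‖ₑ ≤
      ‖mixedGramian (translationSystem C h) (translationSystem C g) hhB hgB‖ₑ := by
  set Θ := mixedGramian (translationSystem C h) (translationSystem C g) hhB hgB with hΘ
  rw [← ae_restrict_iff' hK]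
  have : IsFiniteMeasure (volume.restrict K) := ⟨by rwa [Measure.restrict_apply_univ]⟩
  -- It suffices to bound the integral of `|s|` over each `A ∩ K` by `‖Θ‖` times its measure. The
  -- test functions are as above with `A ∩ K` in place of `K`; by Plancherel each has squared norm
  -- at most that measure.
  refine ae_le_of_forall_setLIntegral_le_of_sigmaFinite (measurable_crossSum 0).enorm
    fun A hA _ => ?_
  rw [Measure.restrict_restrict hA, setLIntegral_const]
  have hAK : MeasurableSet (A ∩ K) := hA.inter hK
  have hu₁ : Measurable ((A ∩ K).indicator fun ξ => conjPhase (crossSum C g h 0 ξ)) :=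
    (measurable_conjPhase.comp (measurable_crossSum 0)).indicator hAK
  have hu₂ : Measurable ((A ∩ K).indicator fun _ => (1 : ℂ)) := measurable_const.indicator hAK
  have hAKv : volume (A ∩ K) < ⊤ := (measure_mono Set.inter_subset_right).trans_lt hKv
  obtain ⟨f₁, hf₁', hfu₁⟩ := exists_isBandLimited hAK hAKv hu₁ 1 (fun ξ => by
    by_cases hξ : ξ ∈ A ∩ K
    · rw [Set.indicator_of_mem hξ, Set.indicator_of_mem hξ]
      exact enorm_conjPhase_le _
    · rw [Set.indicator_of_notMem hξ]
      simp)
  obtain ⟨f₂, hf₂', hfu₂⟩ := exists_isBandLimited hAK hAKv hu₂ 1 (fun ξ => by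
    by_cases hξ : ξ ∈ A ∩ K
    · rw [Set.indicator_of_mem hξ, Set.indicator_of_mem hξ]
      simp
    · rw [Set.indicator_of_notMem hξ]
      simp)
  have hf₁ := hf₁'.mono Set.inter_subset_right
  have hf₂ := hf₂'.mono Set.inter_subset_right
  have key := hg.inner_mixedGramian_eq_integral hC hgB hhB hK hh hcross hf₁ hf₂ 0
  have hint := hg.integrable_mul_crossSum hC hK hh hf₁ hf₂ 0
  simp only [add_zero] at hint
  have heq : (fun ξ => (𝓕 f₁ : L2Space d) ξ * conj ((𝓕 f₂ : L2Space d) ξ) *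
      crossSum C g h 0 ξ) =ᵐ[volume]
      fun ξ => (((A ∩ K).indicator (fun ξ => ‖crossSum C g h 0 ξ‖) ξ : ℝ) : ℂ) := by
    filter_upwards [hfu₁, hfu₂] with ξ h1 h2
    rw [h1, h2]
    by_cases hξ : ξ ∈ A ∩ K
    · rw [Set.indicator_of_mem hξ, Set.indicator_of_mem hξ, Set.indicator_of_mem hξ, map_one,
        mul_one, conjPhase_mul]
    · simp only [Set.indicator_of_notMem hξ, zero_mul, Complex.ofReal_zero]
  have hbound : ∀ f : L2Space d, ∀ u : EuclideanSpace ℝ (Fin d) → ℂ, (∀ ξ, ‖u ξ‖ₑ ≤ 1) →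
      (𝓕 f : L2Space d) =ᵐ[volume] (A ∩ K).indicator u → ‖f‖ₑ ^ 2 ≤ volume (A ∩ K) := by
    intro f u hu hfu
    have h1 : ‖f‖ₑ = eLpNorm (𝓕 f : L2Space d) 2 volume := by
      rw [← ofReal_norm, ← Lp.norm_fourier_eq, ofReal_norm, Lp.enorm_def]
    have h2 := eLpNorm_nnreal_pow_eq_lintegral (μ := volume) (p := 2)
      (f := (𝓕 f : L2Space d)) (by norm_num)
    norm_num at h2
    rw [h1, h2, ← setLIntegral_one, ← lintegral_indicator hAK]
    refine lintegral_mono_ae ?_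
    filter_upwards [hfu] with ξ hξ
    rw [hξ]
    by_cases hξ' : ξ ∈ A ∩ K
    · rw [Set.indicator_of_mem hξ', Set.indicator_of_mem hξ']
      exact pow_le_one' (hu ξ) 2
    · simp [Set.indicator_of_notMem hξ']
  have hb₁ := hbound f₁ _ (fun ξ => enorm_conjPhase_le _) hfu₁
  have hb₂ := hbound f₂ _ (fun ξ => by simp) hfu₂
  have hprod : ‖f₁‖ₑ * ‖f₂‖ₑ ≤ volume (A ∩ K) := by
    have h1 : (‖f₁‖ₑ * ‖f₂‖ₑ) ^ 2 ≤ volume (A ∩ K) ^ 2 := by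
      rw [mul_pow, sq (volume (A ∩ K))]
      exact mul_le_mul' hb₁ hb₂
    exact (ENNReal.pow_le_pow_left_iff (by norm_num)).1 h1
  have hT : ∀ f : L2Space d, ‖translationOp (0 : EuclideanSpace ℝ (Fin d)) f‖ₑ = ‖f‖ₑ := by
    intro f
    rw [← ofReal_norm, ← ofReal_norm]
    congr 1
    exact (Lp.compMeasurePreservingₗᵢ ℂ (fun x => x - (0 : EuclideanSpace ℝ (Fin d)))
      (measurePreserving_sub_right volume 0)).norm_map f
  rw [integral_congr_ae heq, integral_complex_ofReal] at key
  calc ∫⁻ ξ in A ∩ K, ‖crossSum C g h 0 ξ‖ₑ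
      = ‖((∫ ξ, (A ∩ K).indicator (fun ξ => ‖crossSum C g h 0 ξ‖) ξ : ℝ) : ℂ)‖ₑ := by
        have h0 : ∀ ξ, 0 ≤ (A ∩ K).indicator (fun ξ => ‖crossSum C g h 0 ξ‖) ξ := fun ξ =>
          Set.indicator_nonneg (fun _ _ => norm_nonneg _) ξ
        have hNi : Integrable ((A ∩ K).indicator fun ξ => ‖crossSum C g h 0 ξ‖) := by
          refine (hint.congr heq).norm.congr (Filter.Eventually.of_forall fun ξ => ?_)
          simp only [Complex.norm_real]
          exact Real.norm_of_nonneg (h0 ξ)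
        rw [← ofReal_norm, Complex.norm_real, Real.norm_of_nonneg (integral_nonneg h0),
          ofReal_integral_eq_lintegral_ofReal hNi (Filter.Eventually.of_forall h0),
          ← lintegral_indicator hAK]
        refine lintegral_congr fun ξ => ?_
        by_cases hξ : ξ ∈ A ∩ K
        · rw [Set.indicator_of_mem hξ, Set.indicator_of_mem hξ, ofReal_norm]
        · rw [Set.indicator_of_notMem hξ, Set.indicator_of_notMem hξ, ENNReal.ofReal_zero]
    _ ≤ ‖f₂‖ₑ * (‖Θ‖ₑ * ‖f₁‖ₑ) := by
        erw [← key]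
        have h1 := norm_inner_le_norm (𝕜 := ℂ) (translationOp 0 f₂) (Θ (translationOp 0 f₁))
        have h2 := Θ.le_opNorm (translationOp 0 f₁)
        have h3 := h1.trans (mul_le_mul_of_nonneg_left h2 (norm_nonneg _))
        have h4 := ENNReal.ofReal_le_ofReal h3
        rw [ENNReal.ofReal_mul (norm_nonneg _), ENNReal.ofReal_mul (norm_nonneg _), ofReal_norm,
          ofReal_norm, ofReal_norm, ofReal_norm, hT, hT] at h4
        exact h4
    _ = ‖Θ‖ₑ * (‖f₁‖ₑ * ‖f₂‖ₑ) := by ring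
    _ ≤ ‖Θ‖ₑ * volume (A ∩ K) := by gcongr

end Commutant

/-! ### Assembly of the theorem over the exhausting sets. -/

theorem theoremT (d : ℕ) {P : Type*} [Countable P]
    (C : P → Matrix (Fin d) (Fin d) ℝ) (hC : ∀ p, IsUnit (C p))
    (g h : P → L2Space d)
    (hgB : IsBessel (translationSystem C g)) (hhB : IsBessel (translationSystem C h))
    (hgL : LocallyIntegrableSystem C g) (hhL : LocallyIntegrableSystem C h) :
    -- `Θ = θ_g^* θ_h` is the sum of the rank one operators `⟨·, T_{C_p k} h_p⟩ T_{C_p k} g_p`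
    (∀ f : L2Space d, HasSum
      (fun pk : P × (Fin d → ℤ) =>
        (inner ℂ (translationSystem C h pk) f : ℂ) • translationSystem C g pk)
      (mixedGramian (translationSystem C h) (translationSystem C g) hhB hgB f)) ∧
    -- all the series below converge (absolutely) almost everywhere
    (∀ α ∈ frequencySet C, ∀ᵐ ξ, Summable fun p : activeIndices C α => crossTerm C g h α ξ p) ∧
    (∀ᵐ ξ, Summable fun p : P => crossTerm C g h 0 ξ p) ∧
    -- `Θ` lies in the commutant of the translations iff the cross terms cancel
    (mixedGramian (translationSystem C h) (translationSystem C g) hhB hgB ∈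
        Set.centralizer (Set.range (translationOp (d := d))) ↔
      ∀ α ∈ frequencySet C \ {0}, ∀ᵐ ξ, ∑' p : activeIndices C α, crossTerm C g h α ξ p = 0) ∧
    -- in this case `Θ` is a Fourier multiplier
    (mixedGramian (translationSystem C h) (translationSystem C g) hhB hgB ∈
        Set.centralizer (Set.range (translationOp (d := d))) →
      IsFourierMultiplier
        (mixedGramian (translationSystem C h) (translationSystem C g) hhB hgB)
        (fun ξ => ∑' p : P, crossTerm C g h 0 ξ p)) := by
  obtain ⟨K, hmono, hK, hex⟩ := exists_exhaustion hgB hhB hgL hhL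
  have hKm : ∀ n, MeasurableSet (K n) := fun n => (hK n).1
  have hKv : ∀ n, volume (K n) < ⊤ := fun n => (hK n).2.1
  have hg : ∀ n, LocallyFiniteOn C g (K n) := fun n => (hK n).2.2.1
  have hh : ∀ n, LocallyFiniteOn C h (K n) := fun n => (hK n).2.2.2
  have hsum := ae_summable_crossTerm (ae_tsum_enorm_sq_lt_top_of_exhaustion hKm hg hex)
    (ae_tsum_enorm_sq_lt_top_of_exhaustion hKm hh hex)
  set Θ := mixedGramian (translationSystem C h) (translationSystem C g) hhB hgB with hΘ
  have hforward : Θ ∈ Set.centralizer (Set.range (translationOp (d := d))) →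
      ∀ α ∈ frequencySet C \ {0}, ∀ᵐ ξ, crossSum C g h α ξ = 0 := by
    intro hcomm α hα
    rw [mem_centralizer_translationOp_iff] at hcomm
    have hex' := (measurePreserving_add_right (volume : Measure (EuclideanSpace ℝ (Fin d)))
      α).quasiMeasurePreserving.ae hex
    filter_upwards [hex, hex', ae_all_iff.2 fun n =>
      (hg n).ae_crossSum_eq_zero hC hgB hhB (hKm n) (hKv n) (hh n) hcomm hα.2] with ξ h1 h2 h3
    -- By monotonicity one set of the exhaustion contains both `ξ` and `ξ + α`.
    obtain ⟨m, hm⟩ := h1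
    obtain ⟨n, hn⟩ := h2
    exact h3 (max m n) (hmono (le_max_left m n) hm) (hmono (le_max_right m n) hn)
  have hinner : (∀ α ∈ frequencySet C \ {0}, ∀ᵐ ξ, crossSum C g h α ξ = 0) →
      ∀ m n f₁ f₂, IsBandLimited (K m) f₁ → IsBandLimited (K n) f₂ → ∀ x,
        (inner ℂ (translationOp x f₂) (Θ (translationOp x f₁)) : ℂ) =
        ∫ ξ, (𝓕 f₁ : L2Space d) ξ * conj ((𝓕 f₂ : L2Space d) ξ) * crossSum C g h 0 ξ := by
    intro hcross m n f₁ f₂ hf₁ hf₂ x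
    exact (hg (max m n)).inner_mixedGramian_eq_integral hC hgB hhB (hKm _) (hh _) hcross
      (hf₁.mono (hmono (le_max_left m n))) (hf₂.mono (hmono (le_max_right m n))) x
  refine ⟨hasSum_mixedGramian hhB hgB, fun α _ => ?_, hsum 0, ⟨hforward, fun hcross => ?_⟩,
    fun hcomm => ?_⟩
  · filter_upwards [hsum α] with ξ hξ
    exact hξ.subtype _
  · rw [mem_centralizer_translationOp_iff]
    intro x f
    have hcomp : Θ ∘L translationOp x = translationOp x ∘L Θ := by
      refine ext_isBandLimited hKm hKv hmono hex fun m f₁ hf₁ => ?_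
      -- Against band limited `f₂`, the matrix coefficient of `T_{-x} Θ T_x` is the expanded
      -- function at `x`, which equals its value at `0`.
      have h1 : translationOp (-x) (Θ (translationOp x f₁)) - Θ f₁ = 0 := by
        refine eq_zero_of_inner_isBandLimited hKm hKv hmono hex fun n f₂ hf₂ => ?_
        have h2 := hinner hcross m n f₁ f₂ hf₁ hf₂ x
        have h3 := hinner hcross m n f₁ f₂ hf₁ hf₂ 0
        rw [translationOp_zero, translationOp_zero] at h3
        rw [inner_sub_right, h3, ← inner_translationOp_translationOp x, translationOp_add_apply,
          neg_add_cancel, translationOp_zero, h2, sub_self]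
      have h4 := congrArg (translationOp x) (sub_eq_zero.1 h1)
      rwa [translationOp_add_apply, neg_add_cancel, translationOp_zero] at h4
    exact DFunLike.congr_fun hcomp f
  · have hcross := hforward hcomm
    have hs : (fun ξ => ∑' p : P, crossTerm C g h 0 ξ p) = crossSum C g h 0 :=
      funext fun ξ => (crossSum_zero ξ).symm
    have hbound : ∀ᵐ ξ, ‖crossSum C g h 0 ξ‖ ≤ ‖Θ‖ := by
      filter_upwards [hex, ae_all_iff.2 fun n => (hg n).ae_enorm_crossSum_zero_le hC hgB hhB
        (hKm n) (hKv n) (hh n) hcross] with ξ h1 h2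
      obtain ⟨n, hn⟩ := h1
      exact enorm_le_iff_norm_le.1 (h2 n hn)
    rw [hs]
    refine isFourierMultiplier_of_inner hKm hKv hmono hex (measurable_crossSum 0) hbound
      fun m n f₁ f₂ hf₁ hf₂ => ?_
    have h1 := hinner hcross m n f₁ f₂ hf₁ hf₂ 0
    rwa [translationOp_zero, translationOp_zero] at h1
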